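/- Let $V$ be a finite-dimensional complex vector space, $l,r\ge 0$ integers, $\gamma\subset\mathbb C$ a simple closed curve (the image of an injective continuous map $S^1\to\mathbb C$), and $D_\gamma$ the bounded one of the two connected components of $\mathbb C\setminus\gamma$. Let $\mathrm{Poly}^{l,r}_{V,\gamma}$ be the set of polynomials $f(z)=\sum_{j=0}^{l}a_jz^j$ with $a_j\in\mathrm{End}_{\mathbb C}(V)$ (the leading coefficient $a_l$ may be zero or singular) such that $f(\lambda)$ is invertible for all $\lambda\in\gamma$ and $\det f(z)$ has exactly $r$ roots in $D_\gamma$, counted with multiplicity. It carries the subspace topology from $\mathrm{End}_{\mathbb C}(V)^{l+1}$. Let $\widetilde{\mathrm{Conf}}^{r}_{V,D_\gamma}$ be the subspace of $M_r(\mathbb C)\times\mathrm{Hom}_{\mathbb C}(V,\mathbb C^r)$ consisting of the pairs $(A,\iota)$ such that all eigenvalues of $A$ lie in $D_\gamma$ and the map $V^{\oplus r}\to\mathbb C^r$, $(v_0,\dots,v_{r-1})\mapsto\sum_{i=0}^{r-1}A^i\iota(v_i)$, is surjective. Let $\mathrm{Conf}^r_{V,D_\gamma}=\mathrm{GL}_r(\mathbb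 C)\backslash\widetilde{\mathrm{Conf}}^{r}_{V,D_\gamma}$ be the quotient space by the action $g\cdot(A,\iota)=(gAg^{-1},g\iota)$, and write $[A,\iota]$ for the class of $(A,\iota)$. For $f\in\mathrm{Poly}^{l,r}_{V,\gamma}$ let $\tilde f$ be multiplication by $f$ on the sheaf $\mathcal O_{D_\gamma}(-;V)$ of $V$-valued holomorphic functions on $D_\gamma$, let $\bar z$ be the endomorphism of $H^0(\mathrm{Coker}\,\tilde f)$ induced by multiplication by $z$, and let $c\colon V\to H^0(\mathrm{Coker}\,\tilde f)$ send $v$ to the class of the constant function $v$. **Theorem.** For every $f\in\mathrm{Poly}^{l,r}_{V,\gamma}$ there is a linear isomorphism $\varphi\colon H^0(\mathrm{Coker}\,\tilde f)\to\mathbb C^r$; for every such $\varphi$ the pair $(\varphi\bar z\varphi^{-1},\varphi c)$ belongs to $\widetilde{\mathrm{Conf}}^{r}_{V,D_\gamma}$, and its class does not depend on $\varphi$. The resulting configuration map $$\mathrm{conf}_{D_\gamma}\colon\mathrm{Poly}^{l,r}_{V,\gamma}\to\mathrm{Conf}^r_{V,D_\gamma},\qquad f\mapsto[\varphi\bar z\varphi^{-1},\varphi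 c],$$ is continuous. -/

import Mathlib

open Filter Topology

noncomputable section

namespace ConfigMap

/-! ### Simple closed curves and their bounded complementary component -/

/-- `D` is a connected component of `ℂ \ K`, and it is bounded. For `K` the image of a simple
closed curve there is exactly one such `D`. -/
structure IsBoundedComponent (K D : Set ℂ) : Prop where
  exists_eq : ∃ z ∈ Kᶜ, D = connectedComponentIn Kᶜ z
  isBounded : Bornology.IsBounded D

section Poly

variable {V : Type*} [NormedAddCommGroup V] [NormedSpace ℂ V]

/-! ### Polynomials with coefficients in `End V` -/

/-- Polynomials `∑_{j ≤ l} a_j z^j` with coefficients in `End V`, with the topology of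
`End(V)^(l+1)` (the leading coefficient may vanish). -/
abbrev EndPoly (V : Type*) [NormedAddCommGroup V] [NormedSpace ℂ V] (l : ℕ) : Type _ :=
  Fin (l + 1) → (V →L[ℂ] V)

/-- The value `f(z) = ∑_j a_j z^j`. -/
def EndPoly.eval {l : ℕ} (f : EndPoly V l) (z : ℂ) : V →L[ℂ] V :=
  ∑ j : Fin (l + 1), z ^ (j : ℕ) • f j

theorem EndPoly.analyticAt_eval {l : ℕ} (f : EndPoly V l) (x : ℂ) :
    AnalyticAt ℂ f.eval x := by
  have h : f.eval = fun z => ∑ j : Fin (l + 1), z ^ (j : ℕ) • f j := rfl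
  rw [h]
  exact Finset.analyticAt_fun_sum _ fun j _ => (analyticAt_id.pow _).smul analyticAt_const

/-- The polynomial `det f(z)`, computed in a basis of `V`; see `EndPoly.eval_detPoly`. -/
def EndPoly.detPoly [FiniteDimensional ℂ V] {l : ℕ} (f : EndPoly V l) : Polynomial ℂ :=
  Matrix.det (∑ j : Fin (l + 1), (Polynomial.X ^ (j : ℕ) : Polynomial ℂ) •
    (LinearMap.toMatrix (Module.finBasis ℂ V) (Module.finBasis ℂ V)
      (f j : V →ₗ[ℂ] V)).map Polynomial.C)

theorem EndPoly.eval_detPoly [FiniteDimensional ℂ V] {l : ℕ} (f : EndPoly V l) (z : ℂ) :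
    f.detPoly.eval z = LinearMap.det (f.eval z : V →ₗ[ℂ] V) := by
  rw [← LinearMap.det_toMatrix (Module.finBasis ℂ V), EndPoly.detPoly, ← Polynomial.coe_evalRingHom,
    RingHom.map_det]
  congr 1
  ext i k
  simp only [RingHom.mapMatrix_apply, Matrix.map_apply, Matrix.sum_apply, Matrix.smul_apply,
    LinearMap.toMatrix_apply, EndPoly.eval, map_sum, smul_eq_mul, map_mul]
  simp

open Classical in
/-- The space of `f` of degree at most `l` that are invertible on `K` and such that `det f(z)` has
exactly `r` roots in `D`, counted with multiplicity. -/
def polySpace (V : Type*) [NormedAddCommGroup V] [NormedSpace ℂ V] [FiniteDimensional ℂ V]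
    (K D : Set ℂ) (l r : ℕ) : Set (EndPoly V l) :=
  {f | (∀ z ∈ K, IsUnit (f.eval z)) ∧ f.detPoly.roots.countP (· ∈ D) = r}

/-! ### The cokernel sheaf of multiplication by `f` -/

/-- The stalk at `x` of the sheaf of `V`-valued holomorphic functions. -/
def holStalk (V : Type*) [NormedAddCommGroup V] [NormedSpace ℂ V] (x : ℂ) :
    Submodule ℂ (Germ (𝓝 x) V) where
  carrier := {g | ∃ s : ℂ → V, AnalyticAt ℂ s x ∧ (s : Germ (𝓝 x) V) = g}
  add_mem' := by
    rintro _ _ ⟨s, hs, rfl⟩ ⟨t, ht, rfl⟩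
    exact ⟨s + t, hs.add ht, rfl⟩
  zero_mem' := ⟨0, analyticAt_const, rfl⟩
  smul_mem' := by
    rintro c _ ⟨s, hs, rfl⟩
    exact ⟨c • s, hs.const_smul, rfl⟩

/-- The germ at `x` of a function that is holomorphic near `x`. -/
def holGerm {x : ℂ} (s : ℂ → V) (hs : AnalyticAt ℂ s x) : holStalk V x :=
  ⟨(s : Germ (𝓝 x) V), s, hs, rfl⟩

theorem analyticAt_apply {T : ℂ → (V →L[ℂ] V)} {s : ℂ → V} {x : ℂ} (hT : AnalyticAt ℂ T x)
    (hs : AnalyticAt ℂ s x) : AnalyticAt ℂ (fun z => T z (s z)) x :=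
  ((ContinuousLinearMap.id ℂ (V →L[ℂ] V)).analyticAt_bilinear (T x, s x)).comp₂ hT hs

/-- Pointwise application of an operator-valued function `T`, on germs: `s ↦ (z ↦ T(z) s(z))`. -/
def germApply (T : ℂ → (V →L[ℂ] V)) (x : ℂ) : Germ (𝓝 x) V →ₗ[ℂ] Germ (𝓝 x) V where
  toFun g := Germ.map₂ (fun (S : V →L[ℂ] V) (v : V) => S v) (T : Germ (𝓝 x) (V →L[ℂ] V)) g
  map_add' g h := by
    induction g, h using Germ.inductionOn₂ with
    | _ s t => exact congrArg (Germ.ofFun (l := 𝓝 x)) (funext fun z => map_add (T z) (s z) (t z))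
  map_smul' c g := by
    induction g using Germ.inductionOn with
    | _ s => exact congrArg (Germ.ofFun (l := 𝓝 x)) (funext fun z => map_smul (T z) c (s z))

/-- The map induced on the stalk at `x` by multiplication with a holomorphic `T`. -/
def stalkMul {x : ℂ} (T : ℂ → (V →L[ℂ] V)) (hT : AnalyticAt ℂ T x) :
    holStalk V x →ₗ[ℂ] holStalk V x :=
  (germApply T x).restrict (by
    rintro _ ⟨s, hs, rfl⟩
    exact ⟨fun z => T z (s z), analyticAt_apply hT hs, rfl⟩)

/-- Multiplication by the coordinate `z`, as an operator-valued function. -/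
def coordOp (V : Type*) [NormedAddCommGroup V] [NormedSpace ℂ V] (z : ℂ) : V →L[ℂ] V :=
  z • ContinuousLinearMap.id ℂ V

theorem analyticAt_coordOp (x : ℂ) : AnalyticAt ℂ (coordOp V) x :=
  AnalyticAt.smul (f := fun z : ℂ => z) analyticAt_id analyticAt_const

/-- The stalk at `x` of the cokernel sheaf of multiplication by `f`. -/
abbrev cokerStalk {l : ℕ} (f : EndPoly V l) (x : ℂ) : Type _ :=
  holStalk V x ⧸ LinearMap.range (stalkMul f.eval (f.analyticAt_eval x))

/-- The class in the stalk of the cokernel of a function that is holomorphic near `x`. -/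
def cokerGerm {l : ℕ} (f : EndPoly V l) {x : ℂ} (s : ℂ → V) (hs : AnalyticAt ℂ s x) :
    cokerStalk f x :=
  Submodule.Quotient.mk (holGerm s hs)

/-- Multiplication by `z` on the stalk of the cokernel (it commutes with multiplication by `f`). -/
def cokerStalkZ {l : ℕ} (f : EndPoly V l) (x : ℂ) : cokerStalk f x →ₗ[ℂ] cokerStalk f x :=
  Submodule.mapQ _ _ (stalkMul (coordOp V) (analyticAt_coordOp x)) (by
    rintro _ ⟨⟨_, s, hs, rfl⟩, rfl⟩
    refine ⟨holGerm (fun z => coordOp V z (s z)) (analyticAt_apply (analyticAt_coordOp x) hs), ?_⟩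
    refine Subtype.ext (congrArg (Germ.ofFun (l := 𝓝 x)) (funext fun z => ?_))
    exact map_smul (f.eval z) z (s z))

/-- `H⁰(D, Coker f̃)`: the sections over `D` of the cokernel sheaf, that is, of the sheaf
associated with the presheaf `U ↦ 𝒪(U; V) / f 𝒪(U; V)`. They are the families of elements of the
stalks that are locally induced by holomorphic functions. -/
def cokerSections {l : ℕ} (f : EndPoly V l) (D : Set ℂ) :
    Submodule ℂ (∀ x : D, cokerStalk f (x : ℂ)) where
  carrier := {σ | ∀ x : D, ∃ U : Set ℂ, IsOpen U ∧ (x : ℂ) ∈ U ∧ ∃ s : ℂ → V,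
    ∃ hs : AnalyticOnNhd ℂ s U, ∀ (y : D) (hy : (y : ℂ) ∈ U), σ y = cokerGerm f s (hs y hy)}
  add_mem' := by
    intro σ τ hσ hτ x
    obtain ⟨U, hU, hxU, s, hs, hs'⟩ := hσ x
    obtain ⟨W, hW, hxW, t, ht, ht'⟩ := hτ x
    refine ⟨U ∩ W, hU.inter hW, ⟨hxU, hxW⟩, s + t,
      fun y hy => (hs y hy.1).add (ht y hy.2), fun y hy => ?_⟩
    rw [Pi.add_apply, hs' y hy.1, ht' y hy.2]
    rfl
  zero_mem' := fun x => ⟨Set.univ, isOpen_univ, trivial, 0, fun _ _ => analyticAt_const,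
    fun _ _ => rfl⟩
  smul_mem' := by
    intro c σ hσ x
    obtain ⟨U, hU, hxU, s, hs, hs'⟩ := hσ x
    refine ⟨U, hU, hxU, c • s, fun y hy => (hs y hy).const_smul, fun y hy => ?_⟩
    rw [Pi.smul_apply, hs' y hy]
    rfl

/-- Multiplication by `z` on `H⁰(D, Coker f̃)`. -/
def cokerSectionsZ {l : ℕ} (f : EndPoly V l) (D : Set ℂ) :
    cokerSections f D →ₗ[ℂ] cokerSections f D :=
  (LinearMap.pi fun x : D => cokerStalkZ f (x : ℂ) ∘ₗ LinearMap.proj x).restrict (by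
    intro σ hσ x
    obtain ⟨U, hU, hxU, s, hs, hs'⟩ := hσ x
    refine ⟨U, hU, hxU, fun z => coordOp V z (s z),
      fun y hy => analyticAt_apply (analyticAt_coordOp y) (hs y hy), fun y hy => ?_⟩
    change cokerStalkZ f (y : ℂ) (σ y) = _
    rw [hs' y hy]
    rfl)

/-- The map `V → 𝒪(D; V) → H⁰(D, Coker f̃)`, `v ↦` the class of the constant function `v`. -/
def cokerConst {l : ℕ} (f : EndPoly V l) (D : Set ℂ) : V →ₗ[ℂ] cokerSections f D where
  toFun v := ⟨fun _ => cokerGerm f (fun _ => v) analyticAt_const,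
    fun _ => ⟨Set.univ, isOpen_univ, trivial, fun _ => v, fun _ _ => analyticAt_const,
      fun _ _ => rfl⟩⟩
  map_add' _ _ := rfl
  map_smul' _ _ := rfl

end Poly

/-! ### Configuration spaces -/

section Conf

variable (V : Type*) [NormedAddCommGroup V] [NormedSpace ℂ V]

/-- `(A, ι)` is a `V`-configuration of rank `r` over `U`. -/
structure IsConfiguration (U : Set ℂ) (r : ℕ)
    (p : Matrix (Fin r) (Fin r) ℂ × (V →L[ℂ] (Fin r → ℂ))) : Prop where
  spectrum_subset : spectrum ℂ p.1 ⊆ U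
  surjective : Function.Surjective
    fun v : Fin r → V => ∑ i : Fin r, (p.1 ^ (i : ℕ)).mulVec (p.2 (v i))

/-- The space of `V`-configurations of rank `r` over `U`, a subspace of
`M_r(ℂ) × Hom(V, ℂ^r)`. -/
def PreConf (U : Set ℂ) (r : ℕ) : Type _ :=
  {p : Matrix (Fin r) (Fin r) ℂ × (V →L[ℂ] (Fin r → ℂ)) // IsConfiguration V U r p}

instance (U : Set ℂ) (r : ℕ) : TopologicalSpace (PreConf V U r) :=
  inferInstanceAs (TopologicalSpace
    {p : Matrix (Fin r) (Fin r) ℂ × (V →L[ℂ] (Fin r → ℂ)) // IsConfiguration V U r p})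

variable {V}

/-- Post-composition of `ι : V → ℂ^r` with a matrix. -/
def matComp {r : ℕ} (g : Matrix (Fin r) (Fin r) ℂ) (ι : V →L[ℂ] (Fin r → ℂ)) :
    V →L[ℂ] (Fin r → ℂ) :=
  (LinearMap.toContinuousLinearMap g.mulVecLin).comp ι

@[simp] theorem matComp_apply {r : ℕ} (g : Matrix (Fin r) (Fin r) ℂ) (ι : V →L[ℂ] (Fin r → ℂ))
    (v : V) : matComp g ι v = g.mulVec (ι v) := rfl

theorem IsConfiguration.conj {U : Set ℂ} {r : ℕ}
    {p : Matrix (Fin r) (Fin r) ℂ × (V →L[ℂ] (Fin r → ℂ))} (hp : IsConfiguration V U r p)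
    (g : GL (Fin r) ℂ) :
    IsConfiguration V U r
      ((g : Matrix (Fin r) (Fin r) ℂ) * p.1 * ((g⁻¹ : GL (Fin r) ℂ) : Matrix (Fin r) (Fin r) ℂ),
        matComp (g : Matrix (Fin r) (Fin r) ℂ) p.2) where
  spectrum_subset := by
    have h := spectrum.units_conjugate (R := ℂ) (a := p.1) (u := g)
    exact h.symm ▸ hp.spectrum_subset
  surjective := by
    intro w
    obtain ⟨v, hv⟩ := hp.surjective
      (((g⁻¹ : GL (Fin r) ℂ) : Matrix (Fin r) (Fin r) ℂ).mulVec w)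
    refine ⟨v, ?_⟩
    have h : ∀ i : Fin r, (((g : Matrix (Fin r) (Fin r) ℂ) * p.1 *
        ((g⁻¹ : GL (Fin r) ℂ) : Matrix (Fin r) (Fin r) ℂ)) ^ (i : ℕ)).mulVec
        (matComp (g : Matrix (Fin r) (Fin r) ℂ) p.2 (v i)) =
        (g : Matrix (Fin r) (Fin r) ℂ).mulVec ((p.1 ^ (i : ℕ)).mulVec (p.2 (v i))) := by
      intro i
      have h1 := Units.conj_pow g p.1 (i : ℕ)
      rw [h1, matComp_apply, Matrix.mulVec_mulVec, Matrix.mulVec_mulVec, mul_assoc,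
        Units.inv_mul, mul_one]
    simp only [h]
    rw [← Matrix.mulVec_sum, show (∑ i : Fin r, (p.1 ^ (i : ℕ)).mulVec (p.2 (v i))) = _ from hv,
      Matrix.mulVec_mulVec, Units.mul_inv, Matrix.one_mulVec]

/-- The left action `g • (A, ι) = (g A g⁻¹, g ∘ ι)` of `GL_r(ℂ)`. -/
instance (U : Set ℂ) (r : ℕ) : MulAction (GL (Fin r) ℂ) (PreConf V U r) where
  smul g p := ⟨_, p.2.conj g⟩
  one_smul p := by
    refine Subtype.ext (Prod.ext ?_ ?_)
    · change (1 : Matrix (Fin r) (Fin r) ℂ) * p.1.1 * ((1⁻¹ : GL (Fin r) ℂ) : Matrix _ _ ℂ) = p.1.1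
      simp
    · refine ContinuousLinearMap.ext fun v => ?_
      change (1 : Matrix (Fin r) (Fin r) ℂ).mulVec (p.1.2 v) = p.1.2 v
      simp
  mul_smul g h p := by
    refine Subtype.ext (Prod.ext ?_ ?_)
    · change ((g * h : GL (Fin r) ℂ) : Matrix (Fin r) (Fin r) ℂ) * p.1.1 *
        (((g * h)⁻¹ : GL (Fin r) ℂ) : Matrix (Fin r) (Fin r) ℂ) =
        (g : Matrix (Fin r) (Fin r) ℂ) * ((h : Matrix (Fin r) (Fin r) ℂ) * p.1.1 *
          ((h⁻¹ : GL (Fin r) ℂ) : Matrix (Fin r) (Fin r) ℂ)) *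
          ((g⁻¹ : GL (Fin r) ℂ) : Matrix (Fin r) (Fin r) ℂ)
      rw [mul_inv_rev, Units.val_mul, Units.val_mul]
      simp only [mul_assoc]
    · refine ContinuousLinearMap.ext fun v => ?_
      change ((g : Matrix (Fin r) (Fin r) ℂ) * (h : Matrix (Fin r) (Fin r) ℂ)).mulVec (p.1.2 v) =
        (g : Matrix (Fin r) (Fin r) ℂ).mulVec
          ((h : Matrix (Fin r) (Fin r) ℂ).mulVec (p.1.2 v))
      rw [Matrix.mulVec_mulVec]

/-- The configuration space: the quotient of `PreConf V U r` by `GL_r(ℂ)`, with the quotient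
topology. -/
abbrev Conf (V : Type*) [NormedAddCommGroup V] [NormedSpace ℂ V] (U : Set ℂ) (r : ℕ) : Type _ :=
  Quotient (MulAction.orbitRel (GL (Fin r) ℂ) (PreConf V U r))

/-- The class `[A, ι]`. -/
def Conf.mk {U : Set ℂ} {r : ℕ} (p : Matrix (Fin r) (Fin r) ℂ × (V →L[ℂ] (Fin r → ℂ)))
    (hp : IsConfiguration V U r p) : Conf V U r :=
  Quotient.mk _ (⟨p, hp⟩ : PreConf V U r)

/-- The pair `(φ ∘ z ∘ φ⁻¹, φ ∘ π ∘ const)` attached to `f` and to an isomorphism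
`φ : H⁰(D, Coker f̃) ≃ ℂ^r`. -/
def configPair [FiniteDimensional ℂ V] {l r : ℕ} (f : EndPoly V l) (D : Set ℂ)
    (φ : cokerSections f D ≃ₗ[ℂ] (Fin r → ℂ)) :
    Matrix (Fin r) (Fin r) ℂ × (V →L[ℂ] (Fin r → ℂ)) :=
  (LinearMap.toMatrix' (φ.toLinearMap ∘ₗ cokerSectionsZ f D ∘ₗ φ.symm.toLinearMap),
    LinearMap.toContinuousLinearMap (φ.toLinearMap ∘ₗ cokerConst f D))

end Conf

end ConfigMap

end

noncomputable section

namespace ConfigMap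

/-! ### Cokernels of square matrices over `ℂ[X]` -/

section Algebra

open Polynomial

/-! Let d = dim V, let M be the matrix of f in a basis of V, and factor det f = m n, where m is
monic with roots the r roots in D and n has no root in D. Every section of the cokernel sheaf is the
class of a vector of polynomials (`polyClass_surjective`: Taylor expansion at the zeros of det f and
the Chinese remainder theorem), and p represents zero exactly when p ∈ M ℂ[X]^d + m ℂ[X]^d
(`polyClass_eq_zero_iff_of_factor`: adjugate and Bézout). So H⁰ is the quotient of ℂ[X]^d by this
submodule, and its dimension is deg m = r (`finrank_quotient_rangeAdd`: Smith normal form and a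
comparison of determinants). Since m annihilates H⁰, the eigenvalues of multiplication by z are
roots of m; since vectors of polynomials of degree < r represent all sections, the surjectivity
condition holds. Two choices of φ differ by an element of GL_r.

For continuity, reduction modulo m presents H⁰ as the cokernel of an endomorphism `redMul` of
(ℂ^r)^d. Its rank is constant, so the cokernels can be identified with ℂ^r continuously near any
point (`exists_continuousAt_coker`), provided that m varies continuously.

To obtain a continuous m without perturbation theory for roots, f is replaced by a pair (f, c),
where c enumerates the roots in D. These pairs form a closed subset `rootCover` of the product with
the compact space closure(D)^r. Hence its projection to the space of all f is a closed surjection,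
so a quotient map, and continuity can be tested on the cover, where m = ∏ (X - c_i) is visibly
continuous. -/

theorem exists_comp_of_range_le {R P M N : Type*} [CommRing R] [AddCommGroup P] [Module R P]
    [AddCommGroup M] [Module R M] [AddCommGroup N] [Module R N] [Module.Projective R P]
    {a : P →ₗ[R] N} {b : M →ₗ[R] N} (h : LinearMap.range a ≤ LinearMap.range b) :
    ∃ c : P →ₗ[R] M, b ∘ₗ c = a := by
  obtain ⟨c, hc⟩ := Module.projective_lifting_property b.rangeRestrict
    (a.codRestrict (LinearMap.range b) fun x => h ⟨x, rfl⟩) b.surjective_rangeRestrict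
  refine ⟨c, LinearMap.ext fun x => ?_⟩
  exact congrArg Subtype.val (LinearMap.congr_fun hc x)

/-- The submodule `M R^d + m R^d`. -/
def rangeAdd {d : ℕ} (M : Matrix (Fin d) (Fin d) ℂ[X]) (m : ℂ[X]) :
    Submodule ℂ[X] (Fin d → ℂ[X]) :=
  LinearMap.range M.mulVecLin ⊔ LinearMap.range (LinearMap.lsmul ℂ[X] (Fin d → ℂ[X]) m)

theorem mem_rangeAdd {d : ℕ} {M : Matrix (Fin d) (Fin d) ℂ[X]} {m : ℂ[X]} {p : Fin d → ℂ[X]} :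
    p ∈ rangeAdd M m ↔ ∃ q s, M.mulVec q + m • s = p := by
  simp [rangeAdd, Submodule.mem_sup]

/-- A submodule of full rank of `ℂ[X]^d` is the range of an injective endomorphism whose
determinant has degree the codimension. -/
theorem exists_endomorphism_range_eq {d : ℕ} (N : Submodule ℂ[X] (Fin d → ℂ[X]))
    (h : Module.finrank ℂ[X] N = Module.finrank ℂ[X] (Fin d → ℂ[X])) :
    ∃ G : (Fin d → ℂ[X]) →ₗ[ℂ[X]] (Fin d → ℂ[X]), Function.Injective G ∧
      LinearMap.range G = N ∧
      Module.finrank ℂ ((Fin d → ℂ[X]) ⧸ N) = (LinearMap.det G).natDegree := by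
  let b := Pi.basisFun ℂ[X] (Fin d)
  let a := Submodule.smithNormalFormCoeffs b h
  let b' := Submodule.smithNormalFormTopBasis b h
  let ab := Submodule.smithNormalFormBotBasis b h
  have hab : ∀ i, (ab i : Fin d → ℂ[X]) = a i • b' i := Submodule.smithNormalFormBotBasis_def b h
  have ha : ∀ i, a i ≠ 0 := Submodule.smithNormalFormCoeffs_ne_zero b h
  let e := b'.equiv ab (Equiv.refl _)
  let G := N.subtype ∘ₗ e.toLinearMap
  have hG : G = Matrix.toLin b' b' (Matrix.diagonal a) := by
    refine b'.ext fun i => ?_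
    have : G (b' i) = a i • b' i := by
      change ((e (b' i) : N) : Fin d → ℂ[X]) = _
      rw [Module.Basis.equiv_apply]
      exact hab i
    rw [this, Matrix.toLin_self]
    simp [Matrix.diagonal_apply]
  refine ⟨G, N.injective_subtype.comp e.injective, ?_, ?_⟩
  · rw [LinearMap.range_comp, LinearEquiv.range, Submodule.map_top, Submodule.range_subtype]
  -- The quotient is ∏ ℂ[X]/(a i), each factor of dimension deg (a i), while det G = ∏ a i.
  · rw [hG, LinearMap.det_toLin, Matrix.det_diagonal, natDegree_prod _ _ fun i _ => ha i]
    have : ∀ i, Module.Finite ℂ (ℂ[X] ⧸ Ideal.span ({a i} : Set ℂ[X])) := fun i =>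
      PowerBasis.finite (AdjoinRoot.powerBasis (ha i))
    rw [((N.quotientEquivPiSpan b h).restrictScalars ℂ).finrank_eq, Module.finrank_pi_fintype]
    exact Finset.sum_congr rfl fun i _ => (AdjoinRoot.powerBasis (ha i)).finrank

/-- Let N be the submodule and G an injective endomorphism with range N; the codimension is deg det
G. As N contains the ranges of M and of m, there are factorizations M = G H and m = G G', and n N ⊆
range M gives H H' = n. Thus det G divides m^d and is coprime to n, while det H divides n^d and is
coprime to m. Together with det G · det H = m n this makes det G and m associated. -/
theorem finrank_quotient_rangeAdd {d : ℕ} {M : Matrix (Fin d) (Fin d) ℂ[X]} {m n : ℂ[X]}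
    (hdet : M.det = m * n) (hm : m ≠ 0) (hmn : IsCoprime m n) :
    Module.finrank ℂ ((Fin d → ℂ[X]) ⧸ rangeAdd M m) = m.natDegree := by
  have hinj : Function.Injective (LinearMap.lsmul ℂ[X] (Fin d → ℂ[X]) m) := fun x y hxy =>
    smul_right_injective _ hm hxy
  have hfin : Module.finrank ℂ[X] (rangeAdd M m) = Module.finrank ℂ[X] (Fin d → ℂ[X]) := by
    refine le_antisymm (Submodule.finrank_le _) ?_
    rw [← LinearMap.finrank_range_of_inj hinj]
    exact Submodule.finrank_mono le_sup_right
  obtain ⟨G, hGinj, hGr, hGd⟩ := exists_endomorphism_range_eq _ hfin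
  rw [hGd]
  obtain ⟨H, hH⟩ : ∃ H, G ∘ₗ H = M.mulVecLin :=
    exists_comp_of_range_le (hGr ▸ le_sup_left)
  obtain ⟨G', hG'⟩ : ∃ G', G ∘ₗ G' = LinearMap.lsmul ℂ[X] (Fin d → ℂ[X]) m :=
    exists_comp_of_range_le (hGr ▸ le_sup_right)
  -- This uses n m s = det(M) s = M (adj(M) s).
  have hnN : ∀ p ∈ rangeAdd M m, n • p ∈ LinearMap.range M.mulVecLin := by
    intro p hp
    obtain ⟨q, s, rfl⟩ := mem_rangeAdd.1 hp
    refine ⟨n • q + M.adjugate.mulVec s, ?_⟩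
    rw [Matrix.mulVecLin_apply, Matrix.mulVec_add, Matrix.mulVec_smul, Matrix.mulVec_mulVec,
      Matrix.mul_adjugate, hdet, Matrix.smul_mulVec, Matrix.one_mulVec, smul_add, smul_smul,
      mul_comm n m]
  obtain ⟨H', hH'⟩ : ∃ H', H ∘ₗ H' = LinearMap.lsmul ℂ[X] (Fin d → ℂ[X]) n := by
    refine exists_comp_of_range_le ?_
    rintro _ ⟨p, rfl⟩
    obtain ⟨q, hq⟩ := hnN (G p) (hGr ▸ ⟨p, rfl⟩)
    refine ⟨q, hGinj ?_⟩
    rw [← LinearMap.comp_apply, hH, hq]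
    simp
  have hlsmul : ∀ c : ℂ[X], LinearMap.det (LinearMap.lsmul ℂ[X] (Fin d → ℂ[X]) c) = c ^ d := by
    intro c
    have : LinearMap.lsmul ℂ[X] (Fin d → ℂ[X]) c = c • LinearMap.id := rfl
    rw [this, LinearMap.det_smul]
    simp
  have e1 : LinearMap.det G * LinearMap.det H = m * n := by
    rw [← LinearMap.det_comp, hH, ← hdet, ← Matrix.toLin'_apply', LinearMap.det_toLin']
  have e2 : LinearMap.det G * LinearMap.det G' = m ^ d := by
    rw [← LinearMap.det_comp, hG', hlsmul]
  have e3 : LinearMap.det H * LinearMap.det H' = n ^ d := by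
    rw [← LinearMap.det_comp, hH', hlsmul]
  have c1 : IsCoprime (LinearMap.det G) n :=
    IsCoprime.of_isCoprime_of_dvd_left hmn.pow_left (e2 ▸ dvd_mul_right _ _)
  have c2 : IsCoprime m (LinearMap.det H) :=
    IsCoprime.of_isCoprime_of_dvd_right hmn.pow_right (e3 ▸ dvd_mul_right _ _)
  have d1 : LinearMap.det G ∣ m := c1.dvd_of_dvd_mul_right (e1 ▸ dvd_mul_right _ _)
  have d2 : m ∣ LinearMap.det G := c2.dvd_of_dvd_mul_right (e1 ▸ dvd_mul_right _ _)
  exact natDegree_eq_of_degree_eq (degree_eq_degree_of_associated (associated_of_dvd_dvd d1 d2))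

end Algebra

/-! ### Continuous families of polynomials -/

section ContPoly

open Polynomial

variable {X : Type*} [TopologicalSpace X]

/-- A family of polynomials of bounded degree with continuous coefficients. -/
structure ContPoly (p : X → ℂ[X]) : Prop where
  bounded : ∃ N, ∀ x, (p x).natDegree ≤ N
  continuous_coeff : ∀ k, Continuous fun x => (p x).coeff k

namespace ContPoly

theorem const (p : ℂ[X]) : ContPoly fun _ : X => p :=
  ⟨⟨p.natDegree, fun _ => le_rfl⟩, fun _ => continuous_const⟩

theorem C {a : X → ℂ} (ha : Continuous a) : ContPoly fun x => Polynomial.C (a x) := by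
  refine ⟨⟨0, fun x => (natDegree_C _).le⟩, fun k => ?_⟩
  simp only [coeff_C]
  split_ifs
  exacts [ha, continuous_const]

theorem add {p q : X → ℂ[X]} (hp : ContPoly p) (hq : ContPoly q) :
    ContPoly fun x => p x + q x := by
  obtain ⟨N, hN⟩ := hp.bounded
  obtain ⟨N', hN'⟩ := hq.bounded
  refine ⟨⟨max N N', fun x => natDegree_add_le_of_le (hN x) (hN' x)⟩, fun k => ?_⟩
  simp only [coeff_add]
  exact (hp.continuous_coeff k).add (hq.continuous_coeff k)

theorem mul {p q : X → ℂ[X]} (hp : ContPoly p) (hq : ContPoly q) :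
    ContPoly fun x => p x * q x := by
  obtain ⟨N, hN⟩ := hp.bounded
  obtain ⟨N', hN'⟩ := hq.bounded
  refine ⟨⟨N + N', fun x => natDegree_mul_le_of_le (hN x) (hN' x)⟩, fun k => ?_⟩
  simp only [coeff_mul]
  exact continuous_finsetSum _ fun i _ => (hp.continuous_coeff _).mul (hq.continuous_coeff _)

theorem sub {p q : X → ℂ[X]} (hp : ContPoly p) (hq : ContPoly q) :
    ContPoly fun x => p x - q x := by
  have h := hp.add ((const (-1)).mul hq)
  simpa only [neg_one_mul, ← sub_eq_add_neg] using h

theorem sum {ι : Type*} (s : Finset ι) {p : ι → X → ℂ[X]} (hp : ∀ i ∈ s, ContPoly (p i)) :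
    ContPoly fun x => ∑ i ∈ s, p i x := by
  classical
  induction s using Finset.induction_on with
  | empty => simpa using const 0
  | insert i s hi ih =>
    simp only [Finset.sum_insert hi]
    exact (hp i (Finset.mem_insert_self i s)).add
      (ih fun j hj => hp j (Finset.mem_insert_of_mem hj))

theorem prod {ι : Type*} (s : Finset ι) {p : ι → X → ℂ[X]} (hp : ∀ i ∈ s, ContPoly (p i)) :
    ContPoly fun x => ∏ i ∈ s, p i x := by
  classical
  induction s using Finset.induction_on with
  | empty => simpa using const 1
  | insert i s hi ih =>
    simp only [Finset.prod_insert hi]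
    exact (hp i (Finset.mem_insert_self i s)).mul
      (ih fun j hj => hp j (Finset.mem_insert_of_mem hj))

theorem det {n : Type*} [Fintype n] [DecidableEq n] {M : X → Matrix n n ℂ[X]}
    (hM : ∀ i j, ContPoly fun x => M x i j) : ContPoly fun x => (M x).det := by
  simp only [Matrix.det_apply']
  exact sum _ fun σ _ => (const _).mul (prod _ fun i _ => hM _ _)

theorem comp {Y : Type*} [TopologicalSpace Y] {p : X → ℂ[X]} (hp : ContPoly p) {g : Y → X}
    (hg : Continuous g) : ContPoly fun y => p (g y) :=
  ⟨hp.bounded.imp fun _ h y => h (g y), fun k => (hp.continuous_coeff k).comp hg⟩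

theorem X_pow_modByMonic {m : X → ℂ[X]} {r : ℕ} (hm : ContPoly m) (hmonic : ∀ x, (m x).Monic)
    (hr : ∀ x, (m x).natDegree = r) (j : ℕ) :
    ContPoly fun x => (Polynomial.X ^ j : ℂ[X]) %ₘ m x := by
  have hdeg : ∀ (p : ℂ[X]) x, (p %ₘ m x).degree < r := fun p x => by
    rw [← hr x, ← degree_eq_natDegree (hmonic x).ne_zero]
    exact degree_modByMonic_lt p (hmonic x)
  -- If r = 0 then m = 1 and all remainders vanish. The recursion below starts from X^0 mod m = 1,
  -- which needs positive degree; from there on m has degree r + 1.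
  rcases r with _ | r
  · have h0 : ∀ (p : ℂ[X]) x, p %ₘ m x = 0 := fun p x => by
      have := hdeg p x
      rwa [Nat.cast_zero, ← degree_one (R := ℂ), degree_one, Nat.WithBot.lt_zero_iff,
        degree_eq_bot] at this
    simp only [h0]
    exact const 0
  induction j with
  | zero =>
    have h : ∀ x, (Polynomial.X ^ 0 : ℂ[X]) %ₘ m x = 1 := fun x => by
      rw [pow_zero, modByMonic_eq_self_iff (hmonic x), degree_one,
        degree_eq_natDegree (hmonic x).ne_zero, hr x]
      exact_mod_cast Nat.succ_pos r
    simp only [h]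
    exact const 1
  | succ j ih =>
    -- Multiplying the previous remainder by X gives degree at most r + 1; subtracting its top
    -- coefficient times the monic m brings the degree down again. Continuity of the coefficients
    -- survives this step.
    have h : ∀ x, (Polynomial.X ^ (j + 1) : ℂ[X]) %ₘ m x =
        Polynomial.X * (Polynomial.X ^ j %ₘ m x) -
          Polynomial.C ((Polynomial.X ^ j %ₘ m x).coeff r) * m x := by
      intro x
      set g := (Polynomial.X ^ j : ℂ[X]) %ₘ m x with hg
      have hgd : g.degree < ((r + 1 : ℕ) : WithBot ℕ) := hdeg _ x
      have key : (Polynomial.X * g - Polynomial.C (g.coeff r) * m x).degree < ((r + 1 : ℕ) : WithBot ℕ) := by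
        rw [degree_lt_iff_coeff_zero]
        intro k hk
        rcases hk.eq_or_lt with rfl | hk
        · have h1 : (m x).coeff (r + 1) = 1 := by
            have := (hmonic x).coeff_natDegree
            rwa [hr x] at this
          rw [coeff_sub, coeff_X_mul, coeff_C_mul, h1]
          ring
        · obtain ⟨k, rfl⟩ : ∃ k', k = k' + 1 := ⟨k - 1, by omega⟩
          have h1 : (m x).coeff (k + 1) = 0 :=
            coeff_eq_zero_of_natDegree_lt (by rw [hr x]; exact hk)
          have h2 : g.coeff k = 0 := (degree_lt_iff_coeff_zero _ _).1 hgd _ (by omega)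
          rw [coeff_sub, coeff_X_mul, coeff_C_mul, h1, h2]
          ring
      rw [← hr x, ← degree_eq_natDegree (hmonic x).ne_zero] at key
      refine Eq.trans ?_ ((modByMonic_eq_self_iff (hmonic x)).2 key)
      refine modByMonic_eq_of_dvd_sub (hmonic x) ?_
      have h3 : m x ∣ Polynomial.X ^ j - g := by
        rw [hg, modByMonic_eq_sub_mul_div, sub_sub_cancel]
        exact dvd_mul_right _ _
      have h4 : (Polynomial.X : ℂ[X]) ^ (j + 1) -
          (Polynomial.X * g - Polynomial.C (g.coeff r) * m x) =
          Polynomial.X * (Polynomial.X ^ j - g) + Polynomial.C (g.coeff r) * m x := by ring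
      rw [h4]
      exact dvd_add (h3.mul_left _) (dvd_mul_left _ _)
    simp only [h]
    exact ((const _).mul ih).sub ((C (ih.continuous_coeff r)).mul hm)

/-- The uniform degree bound writes p as a sum of a fixed number of monomials, so linearity of the
remainder reduces the claim to powers of X. -/
theorem modByMonic {p m : X → ℂ[X]} {r : ℕ} (hp : ContPoly p) (hm : ContPoly m)
    (hmonic : ∀ x, (m x).Monic) (hr : ∀ x, (m x).natDegree = r) :
    ContPoly fun x => p x %ₘ m x := by
  obtain ⟨N, hN⟩ := hp.bounded
  have h : ∀ x, p x %ₘ m x = ∑ j ∈ Finset.range (N + 1),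
      Polynomial.C ((p x).coeff j) * (Polynomial.X ^ j %ₘ m x) := by
    intro x
    conv_lhs => rw [(p x).as_sum_range_C_mul_X_pow' (n := N + 1) (Nat.lt_succ_of_le (hN x))]
    rw [← modByMonicHom_apply, map_sum]
    simp only [← smul_eq_C_mul, map_smul, modByMonicHom_apply]
  simp only [h]
  exact sum _ fun j _ => (C (hp.continuous_coeff j)).mul (X_pow_modByMonic hm hmonic hr j)

end ContPoly

end ContPoly

/-! ### Continuous families of cokernels -/

section Coker

/-- A continuous family of endomorphisms with cokernels of constant dimension has a local
continuous family of identifications of the cokernels with `ℂ^r`. -/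
theorem exists_continuousAt_coker {X E : Type*} [TopologicalSpace X] [NormedAddCommGroup E]
    [NormedSpace ℂ E] [FiniteDimensional ℂ E] {F : X → E →L[ℂ] E} (hF : Continuous F) {r : ℕ}
    (hr : ∀ x, Module.finrank ℂ (LinearMap.range (F x : E →ₗ[ℂ] E)) + r = Module.finrank ℂ E)
    (x₀ : X) :
    ∃ (s : (Fin r → ℂ) →L[ℂ] E) (φ : X → E →L[ℂ] (Fin r → ℂ)), ContinuousAt φ x₀ ∧
      ∀ᶠ x in 𝓝 x₀, LinearMap.ker (φ x : E →ₗ[ℂ] (Fin r → ℂ)) =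
        LinearMap.range (F x : E →ₗ[ℂ] E) ∧ ∀ w, φ x (s w) = w := by
  have : CompleteSpace E := FiniteDimensional.complete ℂ E
  obtain ⟨U, hU⟩ := (LinearMap.ker (F x₀ : E →ₗ[ℂ] E)).exists_isCompl
  obtain ⟨W, hW⟩ := (LinearMap.range (F x₀ : E →ₗ[ℂ] E)).exists_isCompl
  have hWr : Module.finrank ℂ W = r := by
    have := Submodule.finrank_add_eq_of_isCompl hW
    have := hr x₀
    omega
  have hUr : Module.finrank ℂ U + r = Module.finrank ℂ E := by
    have h1 := Submodule.finrank_add_eq_of_isCompl hU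
    have h2 := hr x₀
    have h3 := (F x₀ : E →ₗ[ℂ] E).finrank_range_add_finrank_ker
    omega
  let e : (Fin r → ℂ) ≃ₗ[ℂ] W := LinearEquiv.ofFinrankEq _ _ (by simp [hWr])
  let s : (Fin r → ℂ) →L[ℂ] E := LinearMap.toContinuousLinearMap (W.subtype ∘ₗ e.toLinearMap)
  -- F x₀ is injective on U, and the image W of s is a complement of its range, so T x₀ is
  -- bijective. T x stays invertible near x₀, and φ x is the second coordinate of its inverse.
  let T : X → U × (Fin r → ℂ) →L[ℂ] E := fun x => ((F x).comp U.subtypeL).coprod s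
  have hT : ∀ x u w, T x (u, w) = F x u + s w := fun x u w => rfl
  have hTinj : Function.Injective (T x₀ : U × (Fin r → ℂ) →ₗ[ℂ] E) := by
    rw [← LinearMap.ker_eq_bot, LinearMap.ker_eq_bot']
    rintro ⟨u, w⟩ h
    replace h : F x₀ u + s w = 0 := h
    have h1 : F x₀ u = 0 := by
      refine Submodule.disjoint_def.1 hW.disjoint _ ⟨(u : E), rfl⟩ ?_
      rw [eq_neg_of_add_eq_zero_left h]
      exact W.neg_mem (e w).2
    have h2 : u = 0 := Subtype.ext (Submodule.disjoint_def.1 hU.disjoint _ h1 u.2)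
    have h3 : s w = 0 := by rwa [h1, zero_add] at h
    have h4 : w = 0 := e.map_eq_zero_iff.1 (Subtype.ext h3)
    rw [h4, h2]
    rfl
  let T₀ : (U × (Fin r → ℂ)) ≃ₗ[ℂ] E := LinearEquiv.ofInjectiveOfFinrankEq
    (T x₀ : U × (Fin r → ℂ) →ₗ[ℂ] E) hTinj (by simp [hUr])
  have hT₀ : ∀ p, T₀ p = T x₀ p := fun p => rfl
  let S : E →L[ℂ] U × (Fin r → ℂ) := LinearMap.toContinuousLinearMap T₀.symm.toLinearMap
  have hS : ∀ p, S (T₀ p) = p := fun p => T₀.symm_apply_apply p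
  -- Composing with the inverse of T x₀ gives endomorphisms of E with Q x₀ = 1, so openness of the
  -- units and continuity of `Ring.inverse` apply. The default value 0 off the units does no harm,
  -- since only points near x₀ matter.
  let Q : X → E →L[ℂ] E := fun x => (T x).comp S
  have hTc : Continuous T := by
    have h : Continuous fun x => (F x).comp U.subtypeL := hF.clm_comp continuous_const
    have : T = fun x => ((F x).comp U.subtypeL).comp (ContinuousLinearMap.fst ℂ U (Fin r → ℂ)) +
        s.comp (ContinuousLinearMap.snd ℂ U (Fin r → ℂ)) := by
      funext x
      ext p <;> simp [T]
    rw [this]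
    exact (h.clm_comp continuous_const).add continuous_const
  have hQc : Continuous Q := hTc.clm_comp continuous_const
  have hQ₀ : Q x₀ = 1 := by
    ext v
    obtain ⟨p, rfl⟩ := T₀.surjective v
    change T x₀ (S (T₀ p)) = _
    rw [hS, ← hT₀]
    rfl
  refine ⟨s, fun x => ((ContinuousLinearMap.snd ℂ U (Fin r → ℂ)).comp S).comp
    (Ring.inverse (Q x)), ?_, ?_⟩
  · have h1 : ContinuousAt (fun x => Ring.inverse (Q x)) x₀ := by
      have h2 : ContinuousAt Ring.inverse (Q x₀) := by
        rw [hQ₀]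
        exact NormedRing.inverse_continuousAt (1 : (E →L[ℂ] E)ˣ)
      exact ContinuousAt.comp (f := Q) h2 hQc.continuousAt
    exact continuousAt_const.clm_comp h1
  · have hev : ∀ᶠ x in 𝓝 x₀, IsUnit (Q x) := by
      refine hQc.continuousAt.eventually (Units.isOpen.mem_nhds ?_)
      rw [hQ₀]
      exact isUnit_one
    filter_upwards [hev] with x hx
    set φ := ((ContinuousLinearMap.snd ℂ U (Fin r → ℂ)).comp S).comp (Ring.inverse (Q x)) with hφ
    have hinv : ∀ v, Ring.inverse (Q x) (Q x v) = v := fun v => by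
      have := Ring.inverse_mul_cancel _ hx
      exact congrArg (fun L : E →L[ℂ] E => L v) this
    have key : ∀ u w, φ (T x (u, w)) = w := by
      intro u w
      have h1 : T x (u, w) = Q x (T₀ (u, w)) := by
        change _ = T x (S (T₀ (u, w)))
        rw [hS]
      rw [h1, hφ, ContinuousLinearMap.comp_apply, hinv, ContinuousLinearMap.comp_apply, hS]
      rfl
    have hs : ∀ w, φ (s w) = w := fun w => by simpa [hT] using key 0 w
    refine ⟨?_, hs⟩
    have hTx : Function.Injective (T x) := by
      intro p q hpq
      have h1 : Q x (T₀ p) = Q x (T₀ q) := by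
        change T x (S (T₀ p)) = T x (S (T₀ q))
        rw [hS, hS, hpq]
      exact T₀.injective (by rw [← hinv (T₀ p), h1, hinv])
    let FU : U →ₗ[ℂ] E := (F x : E →ₗ[ℂ] E) ∘ₗ U.subtype
    have hFU : Function.Injective FU := fun u v huv => by
      have : T x (u, 0) = T x (v, 0) := by simpa [hT, FU] using huv
      exact congrArg Prod.fst (hTx this)
    have hd : Module.finrank ℂ (LinearMap.range FU) = Module.finrank ℂ U :=
      LinearMap.finrank_range_of_inj hFU
    -- Constancy of the rank enters here: dim U = dim E - r is the rank of F x as well as of F x₀.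
    have e1 : LinearMap.range FU = LinearMap.range (F x : E →ₗ[ℂ] E) := by
      refine Submodule.eq_of_le_of_finrank_eq (LinearMap.range_comp_le_range _ _) ?_
      have := hr x
      omega
    have e2 : LinearMap.range FU = LinearMap.ker (φ : E →ₗ[ℂ] (Fin r → ℂ)) := by
      refine Submodule.eq_of_le_of_finrank_eq ?_ ?_
      · rintro _ ⟨u, rfl⟩
        simpa [hT, FU] using key u 0
      · have h1 := (φ : E →ₗ[ℂ] (Fin r → ℂ)).finrank_range_add_finrank_ker
        have h2 : LinearMap.range (φ : E →ₗ[ℂ] (Fin r → ℂ)) = ⊤ :=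
          LinearMap.range_eq_top.2 fun w => ⟨s w, hs w⟩
        rw [h2, finrank_top, Module.finrank_fin_fun] at h1
        omega
    rw [← e2, e1]

end Coker

/-! ### Polynomial representatives of the sections of the cokernel -/

section Germs

variable {V : Type*} [NormedAddCommGroup V] [NormedSpace ℂ V]

theorem cokerGerm_eq_iff {l : ℕ} {f : EndPoly V l} {x : ℂ} {s t : ℂ → V}
    (hs : AnalyticAt ℂ s x) (ht : AnalyticAt ℂ t x) :
    cokerGerm f s hs = cokerGerm f t ht ↔
      ∃ u, AnalyticAt ℂ u x ∧ ∀ᶠ z in 𝓝 x, f.eval z (u z) = s z - t z := by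
  rw [cokerGerm, cokerGerm, Submodule.Quotient.eq]
  constructor
  · rintro ⟨⟨_, u, hu, rfl⟩, h⟩
    exact ⟨u, hu, Germ.coe_eq.1 (congrArg Subtype.val h)⟩
  · rintro ⟨u, hu, h⟩
    exact ⟨holGerm u hu, Subtype.ext (Germ.coe_eq.2 h)⟩

theorem cokerGerm_congr {l : ℕ} {f : EndPoly V l} {x : ℂ} {s t : ℂ → V} (h : ∀ z, s z = t z)
    (hs : AnalyticAt ℂ s x) (ht : AnalyticAt ℂ t x) : cokerGerm f s hs = cokerGerm f t ht :=
  (cokerGerm_eq_iff hs ht).2 ⟨0, analyticAt_const, Eventually.of_forall fun z => by simp [h z]⟩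

theorem exists_cokerGerm_eq {l : ℕ} {f : EndPoly V l} {x : ℂ} (σ : cokerStalk f x) :
    ∃ (s : ℂ → V) (hs : AnalyticAt ℂ s x), σ = cokerGerm f s hs := by
  obtain ⟨⟨_, s, hs, rfl⟩, rfl⟩ := Submodule.Quotient.mk_surjective _ σ
  exact ⟨s, hs, rfl⟩

end Germs

section Classes

open Polynomial

variable {V : Type*} [NormedAddCommGroup V] [NormedSpace ℂ V] [FiniteDimensional ℂ V]

/-- The matrix of `f(X)` in a basis of `V`. -/
def EndPoly.matPoly {l : ℕ} (f : EndPoly V l) :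
    Matrix (Fin (Module.finrank ℂ V)) (Fin (Module.finrank ℂ V)) ℂ[X] :=
  ∑ j : Fin (l + 1), (Polynomial.X ^ (j : ℕ) : Polynomial ℂ) •
    (LinearMap.toMatrix (Module.finBasis ℂ V) (Module.finBasis ℂ V)
      (f j : V →ₗ[ℂ] V)).map Polynomial.C

theorem EndPoly.det_matPoly {l : ℕ} (f : EndPoly V l) : f.matPoly.det = f.detPoly := rfl

/-- The operator on `V` whose matrix is the value at `z` of a polynomial matrix. -/
def opOf (M : Matrix (Fin (Module.finrank ℂ V)) (Fin (Module.finrank ℂ V)) ℂ[X]) (z : ℂ) :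
    V →ₗ[ℂ] V :=
  Matrix.toLin (Module.finBasis ℂ V) (Module.finBasis ℂ V) ((evalRingHom z).mapMatrix M)

theorem opOf_mul (M N : Matrix (Fin (Module.finrank ℂ V)) (Fin (Module.finrank ℂ V)) ℂ[X])
    (z : ℂ) (v : V) : opOf (M * N) z v = opOf M z (opOf N z v) := by
  rw [opOf, map_mul, Matrix.toLin_mul _ (Module.finBasis ℂ V)]
  rfl

theorem opOf_smul_one (a : ℂ[X]) (z : ℂ) (v : V) :
    opOf (a • (1 : Matrix (Fin (Module.finrank ℂ V)) (Fin (Module.finrank ℂ V)) ℂ[X])) z v =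
      a.eval z • v := by
  have h : (evalRingHom z).mapMatrix
      (a • (1 : Matrix (Fin (Module.finrank ℂ V)) (Fin (Module.finrank ℂ V)) ℂ[X])) =
      a.eval z • 1 := by
    ext i j
    rcases eq_or_ne i j with rfl | hij <;> simp [*]
  rw [opOf, h, map_smul, Matrix.toLin_one]
  rfl

theorem opOf_matPoly {l : ℕ} (f : EndPoly V l) (z : ℂ) (v : V) :
    opOf f.matPoly z v = f.eval z v := by
  have h : (evalRingHom z).mapMatrix f.matPoly =
      LinearMap.toMatrix (Module.finBasis ℂ V) (Module.finBasis ℂ V)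
        (f.eval z : V →ₗ[ℂ] V) := by
    ext i k
    simp only [EndPoly.matPoly, RingHom.mapMatrix_apply, Matrix.map_apply, Matrix.sum_apply,
      Matrix.smul_apply, LinearMap.toMatrix_apply, EndPoly.eval, map_sum, smul_eq_mul, map_mul]
    simp
  rw [opOf, h, Matrix.toLin_toMatrix]
  rfl

theorem analyticAt_opOf (M : Matrix (Fin (Module.finrank ℂ V)) (Fin (Module.finrank ℂ V)) ℂ[X])
    {s : ℂ → V} {x : ℂ} (hs : AnalyticAt ℂ s x) : AnalyticAt ℂ (fun z => opOf M z (s z)) x := by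
  simp only [opOf, Matrix.toLin_apply, Matrix.mulVec, dotProduct]
  refine Finset.analyticAt_fun_sum _ fun i _ => AnalyticAt.smul ?_ analyticAt_const
  refine Finset.analyticAt_fun_sum _ fun k _ => AnalyticAt.mul ?_ ?_
  · exact (AnalyticOnNhd.eval_polynomial (M i k)) x trivial
  · exact ((LinearMap.toContinuousLinearMap ((Module.finBasis ℂ V).coord k)).analyticAt _).comp hs

/-- The `V`-valued polynomial function with given coordinates. -/
def polyFun (p : Fin (Module.finrank ℂ V) → ℂ[X]) (z : ℂ) : V :=
  ∑ k, (p k).eval z • Module.finBasis ℂ V k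

theorem analyticAt_polyFun (p : Fin (Module.finrank ℂ V) → ℂ[X]) (x : ℂ) :
    AnalyticAt ℂ (polyFun p : ℂ → V) x := by
  refine Finset.analyticAt_fun_sum _ fun i _ => AnalyticAt.smul ?_ analyticAt_const
  exact (AnalyticOnNhd.eval_polynomial (p i)) x trivial

theorem polyFun_add (p q : Fin (Module.finrank ℂ V) → ℂ[X]) (z : ℂ) :
    (polyFun (p + q) z : V) = polyFun p z + polyFun q z := by
  simp [polyFun, add_smul, Finset.sum_add_distrib]

theorem polyFun_sub (p q : Fin (Module.finrank ℂ V) → ℂ[X]) (z : ℂ) :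
    (polyFun (p - q) z : V) = polyFun p z - polyFun q z := by
  simp [polyFun, sub_smul, Finset.sum_sub_distrib]

theorem polyFun_smul (a : ℂ[X]) (p : Fin (Module.finrank ℂ V) → ℂ[X]) (z : ℂ) :
    (polyFun (a • p) z : V) = a.eval z • polyFun p z := by
  simp [polyFun, mul_smul, Finset.smul_sum]

theorem polyFun_C_repr (v : V) (z : ℂ) :
    polyFun (fun k => C ((Module.finBasis ℂ V).repr v k)) z = v := by
  simp [polyFun]

theorem repr_polyFun (p : Fin (Module.finrank ℂ V) → ℂ[X]) (z : ℂ)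
    (k : Fin (Module.finrank ℂ V)) :
    (Module.finBasis ℂ V).repr (polyFun p z) k = (p k).eval z := by
  rw [polyFun, Module.Basis.repr_sum_self]

theorem opOf_polyFun (M : Matrix (Fin (Module.finrank ℂ V)) (Fin (Module.finrank ℂ V)) ℂ[X])
    (p : Fin (Module.finrank ℂ V) → ℂ[X]) (z : ℂ) :
    opOf M z (polyFun p z : V) = polyFun (M.mulVec p) z := by
  rw [opOf, Matrix.toLin_apply]
  refine Finset.sum_congr rfl fun i _ => ?_
  congr 1
  simp only [Matrix.mulVec, dotProduct, repr_polyFun, eval_finsetSum, eval_mul]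
  rfl

theorem opOf_adjugate_eval {l : ℕ} (f : EndPoly V l) (z : ℂ) (v : V) :
    opOf f.matPoly.adjugate z (f.eval z v) = f.detPoly.eval z • v := by
  rw [← opOf_matPoly, ← opOf_mul, Matrix.adjugate_mul, opOf_smul_one, f.det_matPoly]

theorem eval_opOf_adjugate {l : ℕ} (f : EndPoly V l) (z : ℂ) (v : V) :
    f.eval z (opOf f.matPoly.adjugate z v) = f.detPoly.eval z • v := by
  rw [← opOf_matPoly, ← opOf_mul, Matrix.mul_adjugate, opOf_smul_one, f.det_matPoly]

/-- Since f · adj f = det f = a g with g invertible near x, a solution is u = g⁻¹ adj(f) v. In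
particular a multiple of a vanishes in the stalk of the cokernel. -/
theorem exists_analyticAt_eval_eq {l : ℕ} {f : EndPoly V l} {a g : ℂ[X]} {x : ℂ}
    (h : f.detPoly = a * g) (hg : g.eval x ≠ 0) {v : ℂ → V} (hv : AnalyticAt ℂ v x) :
    ∃ u : ℂ → V, AnalyticAt ℂ u x ∧ ∀ᶠ z in 𝓝 x, f.eval z (u z) = a.eval z • v z := by
  have hga : AnalyticAt ℂ (fun z => g.eval z) x := (AnalyticOnNhd.eval_polynomial g) x trivial
  refine ⟨fun z => (g.eval z)⁻¹ • opOf f.matPoly.adjugate z (v z),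
    (hga.inv hg).smul (analyticAt_opOf _ hv), ?_⟩
  filter_upwards [hga.continuousAt.eventually_ne hg] with z hz
  rw [map_smul, eval_opOf_adjugate, h, eval_mul, smul_smul]
  congr 1
  field_simp

/-- If the multiplicity j of x in w were less than k, cancelling (z - x)^j away from x and letting z
→ x would make the cofactor vanish at x. Continuity of v is enough for the limit. -/
theorem pow_dvd_of_eventually_eq {w : ℂ[X]} {x : ℂ} {k : ℕ} {v : ℂ → ℂ} (hv : ContinuousAt v x)
    (h : ∀ᶠ z in 𝓝 x, w.eval z = (z - x) ^ k * v z) : (X - C x) ^ k ∣ w := by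
  rcases eq_or_ne w 0 with rfl | hw
  · exact dvd_zero _
  rw [← le_rootMultiplicity_iff hw]
  by_contra! hlt
  obtain ⟨g, hwg, hg⟩ := exists_eq_pow_rootMultiplicity_mul_and_not_dvd w hw x
  set j := rootMultiplicity x w
  refine hg (dvd_iff_isRoot.2 ?_)
  have h1 : ∀ᶠ z in 𝓝[≠] x, g.eval z = (z - x) ^ (k - j) * v z := by
    filter_upwards [h.filter_mono nhdsWithin_le_nhds, self_mem_nhdsWithin] with z hz hzx
    have hne : z - x ≠ 0 := sub_ne_zero.2 hzx
    refine mul_left_cancel₀ (pow_ne_zero j hne) ?_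
    rw [← mul_assoc, ← pow_add, Nat.add_sub_cancel' hlt.le, ← hz]
    conv_rhs => rw [hwg]
    simp
  have h2 : Tendsto (fun z => g.eval z) (𝓝[≠] x) (𝓝 (g.eval x)) :=
    g.continuous.continuousAt.tendsto.mono_left nhdsWithin_le_nhds
  have h3 : Tendsto (fun z => (z - x) ^ (k - j) * v z) (𝓝[≠] x) (𝓝 ((x - x) ^ (k - j) * v x)) := by
    have : ContinuousAt (fun z => (z - x) ^ (k - j) * v z) x := by fun_prop
    exact this.tendsto.mono_left nhdsWithin_le_nhds
  have h4 := tendsto_nhds_unique (h2.congr' h1) h3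
  rw [sub_self, zero_pow (by omega), zero_mul] at h4
  exact h4

/-- Each step splits off the value at x of the current remainder; `dslope` is the next, still
analytic, remainder. -/
theorem exists_taylor {s : ℂ → V} {x : ℂ} (hs : AnalyticAt ℂ s x) (k : ℕ) :
    ∃ (p : Fin (Module.finrank ℂ V) → ℂ[X]) (v : ℂ → V), AnalyticAt ℂ v x ∧
      ∀ z, s z = polyFun p z + (z - x) ^ k • v z := by
  induction k with
  | zero => exact ⟨0, s, hs, fun z => by simp [polyFun]⟩
  | succ k ih =>
    obtain ⟨p, v, ⟨q, hq⟩, h⟩ := ih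
    refine ⟨p + (X - C x) ^ k • fun i => C ((Module.finBasis ℂ V).repr (v x) i), dslope v x,
      ⟨_, hq.has_fpower_series_dslope_fslope⟩, fun z => ?_⟩
    have h1 : v z = v x + (z - x) • dslope v x z := by rw [sub_smul_dslope]; abel
    rw [h z, polyFun_add, polyFun_smul, polyFun_C_repr]
    conv_lhs => rw [h1]
    simp only [eval_pow, eval_sub, eval_X, eval_C, smul_add, smul_smul, pow_succ]
    abel

/-- The section of the cokernel sheaf given by a polynomial. -/
def polyClass {l : ℕ} (f : EndPoly V l) (D : Set ℂ) :
    (Fin (Module.finrank ℂ V) → ℂ[X]) →ₗ[ℂ] cokerSections f D where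
  toFun p := ⟨fun x => cokerGerm f (polyFun p) (analyticAt_polyFun p x),
    fun _ => ⟨Set.univ, isOpen_univ, trivial, polyFun p, fun x _ => analyticAt_polyFun p x,
      fun _ _ => rfl⟩⟩
  map_add' p q := Subtype.ext <| funext fun x =>
    cokerGerm_congr (polyFun_add p q) _ ((analyticAt_polyFun p x).add (analyticAt_polyFun q x))
  map_smul' c p := Subtype.ext <| funext fun x => by
    refine cokerGerm_congr (t := c • polyFun p) (fun z => ?_) _ (analyticAt_polyFun p x).const_smul
    simp [polyFun, mul_smul, Finset.smul_sum]

theorem polyClass_eq_zero_iff {l : ℕ} {f : EndPoly V l} {D : Set ℂ}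
    {p : Fin (Module.finrank ℂ V) → ℂ[X]} :
    polyClass f D p = 0 ↔ ∀ x ∈ D, ∃ u, AnalyticAt ℂ u x ∧
      ∀ᶠ z in 𝓝 x, f.eval z (u z) = polyFun p z := by
  have h : polyClass f D p = 0 ↔ ∀ x : D,
      cokerGerm f (polyFun p) (analyticAt_polyFun p (x : ℂ)) =
        cokerGerm f (fun _ => 0) analyticAt_const := by
    rw [Subtype.ext_iff, funext_iff]
    rfl
  rw [h]
  simp only [cokerGerm_eq_iff, sub_zero, Subtype.forall]

theorem cokerSectionsZ_polyClass {l : ℕ} (f : EndPoly V l) (D : Set ℂ)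
    (p : Fin (Module.finrank ℂ V) → ℂ[X]) :
    cokerSectionsZ f D (polyClass f D p) = polyClass f D ((X : ℂ[X]) • p) := by
  refine Subtype.ext <| funext fun x => ?_
  refine cokerGerm_congr (s := fun z => coordOp V z (polyFun p z)) (fun z => ?_)
    (analyticAt_apply (analyticAt_coordOp _) (analyticAt_polyFun p x)) _
  rw [polyFun_smul, eval_X]
  rfl

theorem cokerConst_eq_polyClass {l : ℕ} (f : EndPoly V l) (D : Set ℂ) (v : V) :
    cokerConst f D v = polyClass f D fun k => C ((Module.finBasis ℂ V).repr v k) :=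
  Subtype.ext <| funext fun _ =>
    cokerGerm_congr (fun z => (polyFun_C_repr v z).symm) analyticAt_const _

/-- With k the multiplicity of x as a root of det f, a Taylor remainder of order k at x lies in the
image of f. So each stalk element depends only on a Taylor polynomial, and the Chinese remainder
theorem matches finitely many of these at once. Where det f is nonzero, k = 0 and there is no
condition. -/
theorem polyClass_surjective {l : ℕ} {f : EndPoly V l} (hf : f.detPoly ≠ 0) (D : Set ℂ) :
    Function.Surjective (polyClass f D) := by
  intro σ
  have h1 : ∀ x : ℂ, ∃ T : Fin (Module.finrank ℂ V) → ℂ[X], ∀ hx : x ∈ D,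
      σ.1 ⟨x, hx⟩ = cokerGerm f (polyFun T) (analyticAt_polyFun T x) := by
    intro x
    by_cases hx : x ∈ D
    · obtain ⟨s, hs, hσ⟩ := exists_cokerGerm_eq (σ.1 ⟨x, hx⟩)
      obtain ⟨g, hfg, hg⟩ := exists_eq_pow_rootMultiplicity_mul_and_not_dvd f.detPoly hf x
      obtain ⟨T, v, hv, hT⟩ := exists_taylor hs (rootMultiplicity x f.detPoly)
      refine ⟨T, fun _ => hσ.trans ((cokerGerm_eq_iff hs _).2 ?_)⟩
      obtain ⟨u, hu, hu'⟩ := exists_analyticAt_eval_eq hfg (fun h => hg (dvd_iff_isRoot.2 h)) hv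
      refine ⟨u, hu, hu'.mono fun z hz => ?_⟩
      rw [hz, hT z]
      simp
    · exact ⟨0, fun h => absurd h hx⟩
  choose T hT using h1
  have h2 : ∀ k, ∃ q : ℂ[X], ∀ x : f.detPoly.roots.toFinset,
      q - T x k ∈ Ideal.span {(X - C (x : ℂ)) ^ rootMultiplicity (x : ℂ) f.detPoly} := by
    intro k
    refine Ideal.exists_forall_sub_mem_ideal (fun x y hxy => ?_) _
    change IsCoprime (Ideal.span _) (Ideal.span _)
    rw [Ideal.isCoprime_span_singleton_iff]
    refine IsCoprime.pow (isCoprime_X_sub_C_of_isUnit_sub ?_)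
    exact (sub_ne_zero.2 fun h => hxy (Subtype.ext h)).isUnit
  choose q hq using h2
  refine ⟨q, Subtype.ext <| funext fun x => ?_⟩
  rw [hT x x.2]
  refine (cokerGerm_eq_iff _ _).2 ?_
  obtain ⟨g, hfg, hg⟩ := exists_eq_pow_rootMultiplicity_mul_and_not_dvd f.detPoly hf (x : ℂ)
  have h3 : ∀ k, (X - C (x : ℂ)) ^ rootMultiplicity (x : ℂ) f.detPoly ∣ q k - T x k := by
    intro k
    by_cases hx : (x : ℂ) ∈ f.detPoly.roots.toFinset
    · exact Ideal.mem_span_singleton.1 (hq k ⟨x, hx⟩)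
    · rw [Multiset.mem_toFinset, mem_roots hf] at hx
      rw [rootMultiplicity_eq_zero hx, pow_zero]
      exact one_dvd _
  choose w hw using h3
  obtain ⟨u, hu, hu'⟩ := exists_analyticAt_eval_eq hfg (fun h => hg (dvd_iff_isRoot.2 h))
    (analyticAt_polyFun w (x : ℂ) : AnalyticAt ℂ (polyFun w : ℂ → V) x)
  refine ⟨u, hu, hu'.mono fun z hz => ?_⟩
  rw [hz, ← polyFun_smul, ← polyFun_sub]
  congr 1
  exact funext fun k => (hw k).symm

theorem polyClass_mulVec {l : ℕ} (f : EndPoly V l) (D : Set ℂ)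
    (q : Fin (Module.finrank ℂ V) → ℂ[X]) : polyClass f D (f.matPoly.mulVec q) = 0 :=
  polyClass_eq_zero_iff.2 fun x _ => ⟨polyFun q, analyticAt_polyFun q x,
    Eventually.of_forall fun z => by rw [← opOf_matPoly, opOf_polyFun]⟩

theorem polyClass_smul_of_factor {l : ℕ} {f : EndPoly V l} {D : Set ℂ} {m n : ℂ[X]}
    (hdet : f.detPoly = m * n) (hn : ∀ x ∈ D, n.eval x ≠ 0)
    (s : Fin (Module.finrank ℂ V) → ℂ[X]) : polyClass f D (m • s) = 0 := by
  refine polyClass_eq_zero_iff.2 fun x hx => ?_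
  obtain ⟨u, hu, hu'⟩ := exists_analyticAt_eval_eq hdet (hn x hx)
    (analyticAt_polyFun s x : AnalyticAt ℂ (polyFun s : ℂ → V) x)
  exact ⟨u, hu, hu'.mono fun z hz => by rw [hz, polyFun_smul]⟩

/-- If p = f u locally on D, then adj(f) p = m n u there, so m divides adj(M) p: its roots all lie
in D, where multiplicities can be compared. Writing adj(M) p = m w and applying M gives M w = n p.
With a m + b n = 1 this yields p = M (b w) + m (a p). -/
theorem polyClass_eq_zero_iff_of_factor {l : ℕ} {f : EndPoly V l} {D : Set ℂ} {m n : ℂ[X]}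
    (hdet : f.detPoly = m * n) (hf : f.detPoly ≠ 0) (hm : ∀ x, m.IsRoot x → x ∈ D)
    (hn : ∀ x ∈ D, n.eval x ≠ 0) (hmn : IsCoprime m n)
    {p : Fin (Module.finrank ℂ V) → ℂ[X]} :
    polyClass f D p = 0 ↔ ∃ q s, f.matPoly.mulVec q + m • s = p := by
  have hm0 : m ≠ 0 := fun h => hf (by rw [hdet, h, zero_mul])
  constructor
  · intro h
    rw [polyClass_eq_zero_iff] at h
    have h1 : ∀ k, m ∣ f.matPoly.adjugate.mulVec p k := by
      intro k
      rcases eq_or_ne (f.matPoly.adjugate.mulVec p k) 0 with h0 | h0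
      · rw [h0]
        exact dvd_zero _
      rw [IsAlgClosed.dvd_iff_roots_le_roots hm0 h0, Multiset.le_iff_count]
      intro x
      rw [count_roots, count_roots, le_rootMultiplicity_iff h0]
      by_cases hx : x ∈ D
      · obtain ⟨u, hu, hu'⟩ := h x hx
        obtain ⟨g, hg⟩ := pow_rootMultiplicity_dvd m x
        refine pow_dvd_of_eventually_eq
          (v := fun z => g.eval z * n.eval z * (Module.finBasis ℂ V).coord k (u z)) ?_ ?_
        · have : ContinuousAt (fun z => (Module.finBasis ℂ V).coord k (u z)) x :=
            ContinuousAt.comp (f := u)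
              (LinearMap.toContinuousLinearMap
                ((Module.finBasis ℂ V).coord k)).continuous.continuousAt hu.continuousAt
          exact ((g.continuous.continuousAt).mul n.continuous.continuousAt).mul this
        · filter_upwards [hu'] with z hz
          have h2 := opOf_adjugate_eval f z (u z)
          rw [hz, opOf_polyFun] at h2
          have h3 := congrArg (fun v => (Module.finBasis ℂ V).repr v k) h2
          simp only [repr_polyFun] at h3
          have h4 : f.detPoly.eval z =
              (z - x) ^ rootMultiplicity x m * (g.eval z * n.eval z) := by
            rw [hdet, eval_mul]
            conv_lhs => rw [hg]
            simp [mul_assoc]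
          rw [h3, h4]
          simp [Module.Basis.coord_apply, mul_assoc]
      · rw [rootMultiplicity_eq_zero fun h => hx (hm x h), pow_zero]
        exact one_dvd _
    choose w hw using h1
    replace hw : f.matPoly.adjugate.mulVec p = m • w := funext hw
    have h2 : f.matPoly.mulVec w = n • p := by
      have h3 : m • f.matPoly.mulVec w = m • n • p := by
        rw [← Matrix.mulVec_smul, ← hw, Matrix.mulVec_mulVec, Matrix.mul_adjugate,
          f.det_matPoly, Matrix.smul_mulVec, Matrix.one_mulVec, hdet, smul_smul]
      exact smul_right_injective _ hm0 h3
    obtain ⟨a, b, hab⟩ := hmn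
    refine ⟨b • w, a • p, ?_⟩
    rw [Matrix.mulVec_smul, h2, smul_smul, smul_smul, ← add_smul, mul_comm m a, add_comm, hab,
      one_smul]
  · rintro ⟨q, s, rfl⟩
    rw [map_add, polyClass_mulVec, polyClass_smul_of_factor hdet hn, add_zero]

end Classes

/-! ### Factoring the determinant -/

section Factor

open Polynomial

variable {V : Type*} [NormedAddCommGroup V] [NormedSpace ℂ V] [FiniteDimensional ℂ V]

/-- A factorization `det f = m n` where `m` is monic with roots in `D` and `n` has no root in
`D`. -/
structure RootFactor {l : ℕ} (f : EndPoly V l) (D : Set ℂ) (m n : ℂ[X]) : Prop where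
  det_eq : f.detPoly = m * n
  det_ne_zero : f.detPoly ≠ 0
  monic : m.Monic
  mem_of_isRoot : ∀ x, m.IsRoot x → x ∈ D
  eval_ne_zero : ∀ x ∈ D, n.eval x ≠ 0

theorem RootFactor.isCoprime {l : ℕ} {f : EndPoly V l} {D : Set ℂ} {m n : ℂ[X]}
    (h : RootFactor f D m n) : IsCoprime m n := by
  refine (Polynomial.isCoprime_iff_aeval_ne_zero_of_isAlgClosed ℂ ℂ m n).2 fun a => ?_
  by_cases ha : a ∈ D
  · exact Or.inr (by simpa using h.eval_ne_zero a ha)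
  · exact Or.inl fun h' => ha (h.mem_of_isRoot a (by simpa using h'))

/-- The monic polynomial with the given roots. -/
def rootPoly {r : ℕ} (c : Fin r → ℂ) : ℂ[X] := ∏ i, (X - C (c i))

theorem monic_rootPoly {r : ℕ} (c : Fin r → ℂ) : (rootPoly c).Monic :=
  monic_prod_of_monic _ _ fun _ _ => monic_X_sub_C _

theorem natDegree_rootPoly {r : ℕ} (c : Fin r → ℂ) : (rootPoly c).natDegree = r := by
  rw [rootPoly, natDegree_prod_of_monic _ _ fun _ _ => monic_X_sub_C _]
  simp

theorem roots_rootPoly {r : ℕ} (c : Fin r → ℂ) :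
    (rootPoly c).roots = (Finset.univ.val.map c : Multiset ℂ) := by
  have h : rootPoly c = (((Finset.univ.val.map c : Multiset ℂ)).map fun a => X - C a).prod := by
    rw [Multiset.map_map]
    rfl
  rw [h, roots_multiset_prod_X_sub_C]

theorem isRoot_rootPoly {r : ℕ} {c : Fin r → ℂ} {x : ℂ} :
    (rootPoly c).IsRoot x ↔ ∃ i, c i = x := by
  rw [← mem_roots (monic_rootPoly c).ne_zero, roots_rootPoly]
  simp

theorem contPoly_rootPoly {Y : Type*} [TopologicalSpace Y] {r : ℕ} {c : Y → Fin r → ℂ}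
    (hc : Continuous c) : ContPoly fun y => rootPoly (c y) :=
  ContPoly.prod _ fun i _ => (ContPoly.const X).sub (ContPoly.C ((continuous_apply i).comp hc))

theorem eval_detPoly_ne_zero {l r : ℕ} {K D : Set ℂ} {f : EndPoly V l}
    (hf : f ∈ polySpace V K D l r) {z : ℂ} (hz : z ∈ K) : f.detPoly.eval z ≠ 0 := by
  rw [f.eval_detPoly]
  have h := ((hf.1 z hz).map (ContinuousLinearMap.toLinearMapRingHom (R₁ := ℂ) (M₁ := V))).map
    (LinearMap.det (M := V) (A := ℂ))
  exact h.ne_zero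

theorem detPoly_ne_zero {l r : ℕ} {K D : Set ℂ} (hK : K.Nonempty) {f : EndPoly V l}
    (hf : f ∈ polySpace V K D l r) : f.detPoly ≠ 0 := by
  obtain ⟨z, hz⟩ := hK
  intro h
  exact eval_detPoly_ne_zero hf hz (by rw [h, eval_zero])

theorem exists_rootPoly_dvd {l r : ℕ} {K D : Set ℂ} (hK : K.Nonempty) {f : EndPoly V l}
    (hf : f ∈ polySpace V K D l r) :
    ∃ c : Fin r → ℂ, (∀ i, c i ∈ D) ∧ rootPoly c ∣ f.detPoly := by
  classical
  have h0 := detPoly_ne_zero hK hf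
  have hcard : (f.detPoly.roots.filter (· ∈ D)).card = r := by
    rw [← Multiset.countP_eq_card_filter]
    convert hf.2
  obtain ⟨L, hL⟩ := Quotient.exists_rep (f.detPoly.roots.filter (· ∈ D))
  replace hL : (L : Multiset ℂ) = f.detPoly.roots.filter (· ∈ D) := hL
  rw [← hL, Multiset.coe_card] at hcard
  subst hcard
  refine ⟨fun i => L[i], fun i => ?_, ?_⟩
  · have h1 : L[i] ∈ (L : Multiset ℂ) := List.getElem_mem _
    rw [hL] at h1
    exact (Multiset.mem_filter.1 h1).2
  · have h1 : rootPoly (fun i : Fin L.length => L[i]) =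
        ((L : Multiset ℂ).map fun a => X - C a).prod := by
      rw [rootPoly, Multiset.map_coe, Multiset.prod_coe]
      exact Fin.prod_univ_fun_getElem L fun a => X - C a
    rw [h1, Multiset.prod_X_sub_C_dvd_iff_le_roots h0, hL]
    exact Multiset.filter_le _ _

/-- The r roots c_i already exhaust the roots of det f in D, counted with multiplicity, so none is
left for the cofactor. -/
theorem rootFactor_of_dvd {l r : ℕ} {K D : Set ℂ} (hK : K.Nonempty) {f : EndPoly V l}
    (hf : f ∈ polySpace V K D l r) {c : Fin r → ℂ} (hc : ∀ i, c i ∈ D)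
    (hdvd : rootPoly c ∣ f.detPoly) : ∃ n, RootFactor f D (rootPoly c) n := by
  classical
  have h0 := detPoly_ne_zero hK hf
  obtain ⟨n, hn⟩ := hdvd
  refine ⟨n, hn, h0, monic_rootPoly c, fun x hx => ?_, fun x hx hnx => ?_⟩
  · obtain ⟨i, rfl⟩ := isRoot_rootPoly.1 hx
    exact hc i
  · have hn0 : n ≠ 0 := fun h => h0 (by rw [hn, h, mul_zero])
    have h1 : f.detPoly.roots.countP (· ∈ D) = r := by convert hf.2
    have h2 : (rootPoly c).roots.countP (· ∈ D) = r := by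
      rw [Multiset.countP_eq_card.2]
      · rw [roots_rootPoly]
        simp
      · intro a ha
        rw [mem_roots (monic_rootPoly c).ne_zero, isRoot_rootPoly] at ha
        obtain ⟨i, rfl⟩ := ha
        exact hc i
    rw [hn, roots_mul (hn ▸ h0), Multiset.countP_add, h2] at h1
    have h3 : n.roots.countP (· ∈ D) = 0 := by omega
    exact (Multiset.countP_eq_zero.1 h3) x ((mem_roots hn0).2 hnx) hx

/-- Adding a closure point to a connected set keeps it connected, so a component is closed relative
to the complement of K. -/
theorem IsBoundedComponent.mem_of_mem_closure {K D : Set ℂ} (hD : IsBoundedComponent K D) {x : ℂ}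
    (hx : x ∈ closure D) (hxK : x ∉ K) : x ∈ D := by
  obtain ⟨z, hz, rfl⟩ := hD.exists_eq
  have h1 : IsPreconnected (insert x (connectedComponentIn Kᶜ z)) :=
    isPreconnected_connectedComponentIn.subset_closure (Set.subset_insert _ _)
      (Set.insert_subset hx subset_closure)
  exact h1.subset_connectedComponentIn (Set.mem_insert_of_mem _ (mem_connectedComponentIn hz))
    (Set.insert_subset hxK (connectedComponentIn_subset _ _)) (Set.mem_insert _ _)

/-- This allows roots to be sought in the compact set closure(D): none can lie on K, where det f
does not vanish. -/
theorem mem_of_rootPoly_dvd {l r : ℕ} {K D : Set ℂ} (hD : IsBoundedComponent K D)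
    {f : EndPoly V l} (hf : f ∈ polySpace V K D l r) {c : Fin r → ℂ} (hc : ∀ i, c i ∈ closure D)
    (hdvd : rootPoly c ∣ f.detPoly) (i : Fin r) : c i ∈ D := by
  refine hD.mem_of_mem_closure (hc i) fun hK => eval_detPoly_ne_zero hf hK ?_
  exact (isRoot_rootPoly.2 ⟨i, rfl⟩ : (rootPoly c).IsRoot (c i)).dvd hdvd

theorem contPoly_matPoly {Y : Type*} [TopologicalSpace Y] {l : ℕ} {f : Y → EndPoly V l}
    (hf : Continuous f) (i k : Fin (Module.finrank ℂ V)) :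
    ContPoly fun y => (f y).matPoly i k := by
  simp only [EndPoly.matPoly, Matrix.sum_apply, Matrix.smul_apply, Matrix.map_apply, smul_eq_mul]
  refine ContPoly.sum _ fun j _ => (ContPoly.const _).mul (ContPoly.C ?_)
  simp only [LinearMap.toMatrix_apply]
  have h1 : Continuous fun y => f y j ((Module.finBasis ℂ V) k) :=
    ((continuous_apply j).comp hf).clm_apply continuous_const
  exact (LinearMap.toContinuousLinearMap ((Module.finBasis ℂ V).coord i)).continuous.comp h1

theorem contPoly_detPoly {Y : Type*} [TopologicalSpace Y] {l : ℕ} {f : Y → EndPoly V l}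
    (hf : Continuous f) : ContPoly fun y => (f y).detPoly :=
  ContPoly.det (M := fun y => (f y).matPoly) (contPoly_matPoly hf)

/-- The polynomials `f` together with an enumeration of the roots of `det f` in `D`. -/
def rootCover (V : Type*) [NormedAddCommGroup V] [NormedSpace ℂ V] [FiniteDimensional ℂ V]
    (K D : Set ℂ) (l r : ℕ) : Set (polySpace V K D l r × (Fin r → closure D)) :=
  {p | rootPoly (fun i => (p.2 i : ℂ)) ∣ p.1.1.detPoly}

/-- Divisibility by a monic polynomial is the vanishing of the remainder, whose coefficients are
continuous in both arguments. -/
theorem isClosed_rootCover (K D : Set ℂ) (l r : ℕ) : IsClosed (rootCover V K D l r) := by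
  have h : rootCover V K D l r = ⋂ k : ℕ, {p | (p.1.1.detPoly %ₘ
      rootPoly (fun i => (p.2 i : ℂ))).coeff k = 0} := by
    ext p
    simp only [rootCover, Set.mem_ofPred_eq, Set.mem_iInter]
    rw [← modByMonic_eq_zero_iff_dvd (monic_rootPoly _), Polynomial.ext_iff]
    simp
  rw [h]
  have hc : Continuous fun p : polySpace V K D l r × (Fin r → closure D) =>
      fun i => (p.2 i : ℂ) := by fun_prop
  have hf : Continuous fun p : polySpace V K D l r × (Fin r → closure D) => p.1.1 := by fun_prop
  exact isClosed_iInter fun k => isClosed_eq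
    (((contPoly_detPoly hf).modByMonic (contPoly_rootPoly hc) (fun _ => monic_rootPoly _)
      fun _ => natDegree_rootPoly _).continuous_coeff k) continuous_const

/-- Projection along a compact factor is closed, and a continuous closed surjection is a quotient
map. -/
theorem isQuotientMap_rootCover {K D : Set ℂ} (hK : K.Nonempty) (hD : Bornology.IsBounded D)
    (l r : ℕ) : IsQuotientMap fun p : rootCover V K D l r => p.1.1 := by
  have : CompactSpace (closure D) := isCompact_iff_compactSpace.1 hD.isCompact_closure
  refine IsClosedMap.isQuotientMap ?_ (by fun_prop) ?_
  · exact isClosedMap_fst_of_compactSpace.comp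
      (isClosed_rootCover K D l r).isClosedMap_subtype_val
  · intro f
    obtain ⟨c, hc, hdvd⟩ := exists_rootPoly_dvd hK f.2
    exact ⟨⟨(f, fun i => ⟨c i, subset_closure (hc i)⟩), hdvd⟩, rfl⟩

end Factor

/-! ### Reduction to polynomials of bounded degree -/

section Reduction

open Polynomial

/-- The vector of polynomials of degree less than `r` with the given coefficients. -/
def inclPoly (d r : ℕ) : (Fin d → Fin r → ℂ) →ₗ[ℂ] (Fin d → ℂ[X]) where
  toFun e k := ∑ i, e k i • X ^ (i : ℕ)
  map_add' e e' := funext fun k => by simp [add_smul, Finset.sum_add_distrib]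
  map_smul' c e := funext fun k => by simp [mul_smul, Finset.smul_sum]

theorem inclPoly_apply {d r : ℕ} (e : Fin d → Fin r → ℂ) (k : Fin d) :
    inclPoly d r e k = ∑ i, e k i • X ^ (i : ℕ) := rfl

/-- The coefficients of the remainder modulo `m`. -/
def redPoly (d r : ℕ) (m : ℂ[X]) : (Fin d → ℂ[X]) →ₗ[ℂ] (Fin d → Fin r → ℂ) where
  toFun p k i := (p k %ₘ m).coeff i
  map_add' p q := by ext; simp [add_modByMonic]
  map_smul' c p := by ext; simp [smul_modByMonic]

theorem inclPoly_redPoly {d r : ℕ} {m : ℂ[X]} (hm : m.Monic) (hr : m.natDegree = r)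
    (p : Fin d → ℂ[X]) (k : Fin d) : inclPoly d r (redPoly d r m p) k = p k %ₘ m := by
  have hdeg : (p k %ₘ m).degree < r := by
    rw [← hr, ← degree_eq_natDegree hm.ne_zero]
    exact degree_modByMonic_lt _ hm
  ext j
  change (∑ i : Fin r, (p k %ₘ m).coeff i • X ^ (i : ℕ)).coeff j = _
  rw [finsetSum_coeff]
  simp only [coeff_smul, coeff_X_pow, smul_eq_mul, mul_ite, mul_one, mul_zero]
  rcases lt_or_ge j r with hj | hj
  · rw [Finset.sum_eq_single (⟨j, hj⟩ : Fin r)]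
    · simp
    · intro i _ hi
      rw [if_neg]
      rintro rfl
      exact hi rfl
    · simp
  · rw [(degree_lt_iff_coeff_zero _ _).1 hdeg j hj]
    refine Finset.sum_eq_zero fun i _ => if_neg ?_
    have := i.2
    omega

theorem exists_eq_inclPoly_add {d r : ℕ} {m : ℂ[X]} (hm : m.Monic) (hr : m.natDegree = r)
    (p : Fin d → ℂ[X]) : ∃ s, p = inclPoly d r (redPoly d r m p) + m • s := by
  refine ⟨fun k => p k /ₘ m, funext fun k => ?_⟩
  rw [Pi.add_apply, inclPoly_redPoly hm hr]
  exact (modByMonic_add_div (p k) m).symm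

theorem redPoly_smul {d r : ℕ} {m : ℂ[X]} (hm : m.Monic) (s : Fin d → ℂ[X]) :
    redPoly d r m (m • s) = 0 := by
  ext k i
  change ((m * s k) %ₘ m).coeff i = 0
  rw [(modByMonic_eq_zero_iff_dvd hm).2 (dvd_mul_right _ _), coeff_zero]

theorem redPoly_inclPoly {d r : ℕ} {m : ℂ[X]} (hm : m.Monic) (hr : m.natDegree = r)
    (e : Fin d → Fin r → ℂ) : redPoly d r m (inclPoly d r e) = e := by
  ext k i
  have h : (inclPoly d r e k).degree < m.degree := by
    rw [degree_eq_natDegree hm.ne_zero, hr, degree_lt_iff_coeff_zero]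
    intro j hj
    change (∑ i : Fin r, e k i • X ^ (i : ℕ)).coeff j = 0
    rw [finsetSum_coeff]
    refine Finset.sum_eq_zero fun i _ => ?_
    have := i.2
    rw [coeff_smul, coeff_X_pow, if_neg (by omega), smul_zero]
  change (inclPoly d r e k %ₘ m).coeff i = _
  rw [(modByMonic_eq_self_iff hm).2 h]
  change (∑ i : Fin r, e k i • X ^ (i : ℕ)).coeff i = _
  rw [finsetSum_coeff, Finset.sum_eq_single i]
  · simp
  · intro j _ hj
    rw [coeff_smul, coeff_X_pow, if_neg fun h => hj (Fin.ext h.symm), smul_zero]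
  · simp

theorem continuous_redPoly {Y : Type*} [TopologicalSpace Y] {d r : ℕ} {m : Y → ℂ[X]}
    (hm : ContPoly m) (hmonic : ∀ y, (m y).Monic) (hr : ∀ y, (m y).natDegree = r)
    {p : Y → Fin d → ℂ[X]} (hp : ∀ k, ContPoly fun y => p y k) :
    Continuous fun y => redPoly d r (m y) (p y) :=
  continuous_pi fun k => continuous_pi fun i =>
    ((hp k).modByMonic hm hmonic hr).continuous_coeff i

end Reduction

/-! ### Linear algebra over `ℂ` for modules that are only known to be monoids -/

section Monoid

variable {E H W : Type*} [AddCommGroup E] [Module ℂ E] [AddCommMonoid H] [Module ℂ H]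
  [AddCommGroup W] [Module ℂ W]

/-- Both targets are the quotient of E by the common kernel. Scalar multiplication by -1 supplies
the negation on H. -/
theorem exists_equiv_of_ker_eq {Ψ : E →ₗ[ℂ] H} {φ : E →ₗ[ℂ] W} (hΨ : Function.Surjective Ψ)
    (hφ : Function.Surjective φ) (h : LinearMap.ker Ψ = LinearMap.ker φ) :
    ∃ e : H ≃ₗ[ℂ] W, ∀ x, e (Ψ x) = φ x := by
  let _ : AddCommGroup H := Module.addCommMonoidToAddCommGroup ℂ
  refine ⟨(Ψ.quotKerEquivOfSurjective hΨ).symm.trans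
    ((Submodule.quotEquivOfEq _ _ h).trans (φ.quotKerEquivOfSurjective hφ)), fun x => ?_⟩
  have h1 : (Ψ.quotKerEquivOfSurjective hΨ).symm (Ψ x) = Submodule.Quotient.mk x :=
    (LinearEquiv.symm_apply_eq _).2 rfl
  rw [LinearEquiv.trans_apply, h1]
  rfl

theorem nonempty_equiv_of_finrank_eq [Module.Finite ℂ H] {r : ℕ} (h : Module.finrank ℂ H = r) :
    Nonempty (H ≃ₗ[ℂ] (Fin r → ℂ)) := by
  let _ : AddCommGroup H := Module.addCommMonoidToAddCommGroup ℂ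
  exact ⟨LinearEquiv.ofFinrankEq _ _ (by rw [h, Module.finrank_fin_fun])⟩

theorem finrank_ker_add_of_surjective [FiniteDimensional ℂ E] {Ψ : E →ₗ[ℂ] H}
    (hΨ : Function.Surjective Ψ) :
    Module.finrank ℂ (LinearMap.ker Ψ) + Module.finrank ℂ H = Module.finrank ℂ E := by
  let _ : AddCommGroup H := Module.addCommMonoidToAddCommGroup ℂ
  have h1 := Ψ.finrank_range_add_finrank_ker
  rw [LinearMap.range_eq_top.2 hΨ, finrank_top] at h1
  omega

end Monoid

/-! ### The pair attached to a polynomial -/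

section Pair

open Polynomial

variable {V : Type*} [NormedAddCommGroup V] [NormedSpace ℂ V] [FiniteDimensional ℂ V]

/-- The multiplication by a polynomial matrix on vectors of polynomials, modulo `m`. -/
def redMul (r : ℕ) {d : ℕ} (M : Matrix (Fin d) (Fin d) ℂ[X]) (m : ℂ[X]) :
    (Fin d → Fin r → ℂ) →L[ℂ] (Fin d → Fin r → ℂ) :=
  LinearMap.toContinuousLinearMap
    (redPoly d r m ∘ₗ M.mulVecLin.restrictScalars ℂ ∘ₗ inclPoly d r)

theorem redMul_apply {r d : ℕ} (M : Matrix (Fin d) (Fin d) ℂ[X]) (m : ℂ[X])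
    (e : Fin d → Fin r → ℂ) :
    redMul r M m e = redPoly d r m (M.mulVec (inclPoly d r e)) := rfl

/-- The coefficients modulo `m` of a constant. -/
def redConst (V : Type*) [NormedAddCommGroup V] [NormedSpace ℂ V] [FiniteDimensional ℂ V]
    (r : ℕ) (m : ℂ[X]) : V →L[ℂ] (Fin (Module.finrank ℂ V) → Fin r → ℂ) :=
  LinearMap.toContinuousLinearMap
    { toFun := fun v => redPoly _ r m fun k => C ((Module.finBasis ℂ V).repr v k)
      map_add' := fun v w => by
        rw [← map_add]
        congr 1
        ext1 k
        simp
      map_smul' := fun c v => by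
        rw [← map_smul]
        congr 1
        ext1 k
        simp [smul_eq_C_mul] }

theorem redConst_apply (r : ℕ) (m : ℂ[X]) (v : V) :
    redConst V r m v = redPoly _ r m fun k => C ((Module.finBasis ℂ V).repr v k) := rfl

theorem continuous_redMul {Y : Type*} [TopologicalSpace Y] {d r : ℕ} {m : Y → ℂ[X]}
    (hm : ContPoly m) (hmonic : ∀ y, (m y).Monic) (hr : ∀ y, (m y).natDegree = r)
    {M : Y → Matrix (Fin d) (Fin d) ℂ[X]} (hM : ∀ i j, ContPoly fun y => M y i j) :
    Continuous fun y => redMul r (M y) (m y) := by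
  rw [continuous_clm_apply]
  intro e
  simp only [redMul_apply]
  exact continuous_redPoly hm hmonic hr fun k => by
    simp only [Matrix.mulVec, dotProduct]
    exact ContPoly.sum _ fun j _ => (hM k j).mul (ContPoly.const _)

theorem continuous_redConst {Y : Type*} [TopologicalSpace Y] {r : ℕ} {m : Y → ℂ[X]}
    (hm : ContPoly m) (hmonic : ∀ y, (m y).Monic) (hr : ∀ y, (m y).natDegree = r) :
    Continuous fun y => redConst V r (m y) := by
  rw [continuous_clm_apply]
  intro v
  exact continuous_redPoly hm hmonic hr fun k => ContPoly.const _

/-- The section of the cokernel sheaf given by a polynomial of degree less than `r`. -/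
def redClass {l : ℕ} (f : EndPoly V l) (D : Set ℂ) (r : ℕ) :
    (Fin (Module.finrank ℂ V) → Fin r → ℂ) →ₗ[ℂ] cokerSections f D :=
  polyClass f D ∘ₗ inclPoly _ r

namespace RootFactor

variable {l : ℕ} {f : EndPoly V l} {D : Set ℂ} {m n : ℂ[X]} (h : RootFactor f D m n) {r : ℕ}
  (hr : m.natDegree = r)

include h

theorem polyClass_smul (s : Fin (Module.finrank ℂ V) → ℂ[X]) : polyClass f D (m • s) = 0 :=
  polyClass_smul_of_factor h.det_eq h.eval_ne_zero s

theorem polyClass_eq_zero_iff {p : Fin (Module.finrank ℂ V) → ℂ[X]} :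
    polyClass f D p = 0 ↔ ∃ q s, f.matPoly.mulVec q + m • s = p :=
  polyClass_eq_zero_iff_of_factor h.det_eq h.det_ne_zero h.mem_of_isRoot h.eval_ne_zero
    h.isCoprime

include hr

theorem redClass_redPoly (p : Fin (Module.finrank ℂ V) → ℂ[X]) :
    redClass f D r (redPoly _ r m p) = polyClass f D p := by
  obtain ⟨s, hs⟩ := exists_eq_inclPoly_add h.monic hr p
  conv_rhs => rw [hs, map_add, h.polyClass_smul, add_zero]
  rfl

theorem redClass_surjective : Function.Surjective (redClass f D r) := by
  intro σ
  obtain ⟨p, rfl⟩ := polyClass_surjective h.det_ne_zero D σ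
  exact ⟨_, h.redClass_redPoly hr p⟩

/-- A vector of degree < r has class zero when it equals M q + m s. Reducing modulo m removes m s,
and only q modulo m then matters. -/
theorem ker_redClass : LinearMap.ker (redClass f D r) = LinearMap.range
    (redMul r f.matPoly m : (Fin (Module.finrank ℂ V) → Fin r → ℂ) →ₗ[ℂ]
      (Fin (Module.finrank ℂ V) → Fin r → ℂ)) := by
  ext e
  rw [LinearMap.mem_ker]
  constructor
  · intro he
    obtain ⟨q, s, hqs⟩ := h.polyClass_eq_zero_iff.1 he
    obtain ⟨t, ht⟩ := exists_eq_inclPoly_add h.monic hr q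
    refine ⟨redPoly _ r m q, ?_⟩
    change redMul r f.matPoly m (redPoly _ r m q) = e
    rw [redMul_apply, ← redPoly_inclPoly h.monic hr e, ← hqs, map_add, redPoly_smul h.monic,
      add_zero]
    conv_rhs => rw [ht, Matrix.mulVec_add, Matrix.mulVec_smul, map_add, redPoly_smul h.monic,
      add_zero]
  · rintro ⟨q, rfl⟩
    change redClass f D r (redMul r f.matPoly m q) = 0
    rw [redMul_apply, h.redClass_redPoly hr, polyClass_mulVec]

theorem finrank_cokerSections : Module.finrank ℂ (cokerSections f D) = r := by
  have h1 : LinearMap.ker (polyClass f D) = (rangeAdd f.matPoly m).restrictScalars ℂ := by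
    ext p
    rw [LinearMap.mem_ker, h.polyClass_eq_zero_iff, Submodule.restrictScalars_mem, mem_rangeAdd]
  obtain ⟨e, -⟩ := exists_equiv_of_ker_eq (polyClass_surjective h.det_ne_zero D)
    (Submodule.mkQ_surjective ((rangeAdd f.matPoly m).restrictScalars ℂ))
    (h1.trans (Submodule.ker_mkQ _).symm)
  rw [e.finrank_eq, (Submodule.Quotient.restrictScalarsEquiv ℂ (rangeAdd f.matPoly m)).finrank_eq,
    finrank_quotient_rangeAdd (f.det_matPoly.trans h.det_eq) h.monic.ne_zero h.isCoprime, hr]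

theorem finite_cokerSections : Module.Finite ℂ (cokerSections f D) :=
  Module.Finite.of_surjective _ (h.redClass_surjective hr)

theorem nonempty_equiv : Nonempty (cokerSections f D ≃ₗ[ℂ] (Fin r → ℂ)) := by
  have := h.finite_cokerSections hr
  exact nonempty_equiv_of_finrank_eq (h.finrank_cokerSections hr)

/-- This is the constancy of the rank required by `exists_continuousAt_coker`. -/
theorem finrank_range_redMul_add : Module.finrank ℂ (LinearMap.range
    (redMul r f.matPoly m : (Fin (Module.finrank ℂ V) → Fin r → ℂ) →ₗ[ℂ]
      (Fin (Module.finrank ℂ V) → Fin r → ℂ))) + r =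
      Module.finrank ℂ (Fin (Module.finrank ℂ V) → Fin r → ℂ) := by
  have h1 := finrank_ker_add_of_surjective (h.redClass_surjective hr)
  rwa [h.finrank_cokerSections hr, h.ker_redClass hr] at h1

/-- Multiplication by z is lifted to the scalar matrix X modulo m, so that `continuous_redMul`
covers it too. -/
theorem redClass_redMul_X (e : Fin (Module.finrank ℂ V) → Fin r → ℂ) :
    redClass f D r (redMul r ((X : ℂ[X]) • (1 : Matrix _ _ ℂ[X])) m e) =
      cokerSectionsZ f D (redClass f D r e) := by
  rw [redMul_apply, h.redClass_redPoly hr, Matrix.smul_mulVec, Matrix.one_mulVec,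
    ← cokerSectionsZ_polyClass]
  rfl

theorem redClass_redConst (v : V) :
    redClass f D r (redConst V r m v) = cokerConst f D v := by
  rw [redConst_apply, h.redClass_redPoly hr, cokerConst_eq_polyClass]

end RootFactor

theorem configPair_fst_mulVec {l r : ℕ} (f : EndPoly V l) (D : Set ℂ)
    (φ : cokerSections f D ≃ₗ[ℂ] (Fin r → ℂ)) (σ : cokerSections f D) :
    (configPair f D φ).1.mulVec (φ σ) = φ (cokerSectionsZ f D σ) := by
  rw [configPair, LinearMap.toMatrix'_mulVec]
  simp

theorem configPair_fst_pow_mulVec {l r : ℕ} (f : EndPoly V l) (D : Set ℂ)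
    (φ : cokerSections f D ≃ₗ[ℂ] (Fin r → ℂ)) (i : ℕ) (p : Fin (Module.finrank ℂ V) → ℂ[X]) :
    ((configPair f D φ).1 ^ i).mulVec (φ (polyClass f D p)) =
      φ (polyClass f D ((X : ℂ[X]) ^ i • p)) := by
  induction i with
  | zero => simp
  | succ i ih =>
    rw [pow_succ', ← Matrix.mulVec_mulVec, ih, configPair_fst_mulVec, cokerSectionsZ_polyClass,
      smul_smul, ← pow_succ']

theorem configPair_fst_aeval_mulVec {l r : ℕ} (f : EndPoly V l) (D : Set ℂ)
    (φ : cokerSections f D ≃ₗ[ℂ] (Fin r → ℂ)) (a : ℂ[X])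
    (p : Fin (Module.finrank ℂ V) → ℂ[X]) :
    (aeval (configPair f D φ).1 a).mulVec (φ (polyClass f D p)) = φ (polyClass f D (a • p)) := by
  induction a using Polynomial.induction_on' with
  | add a b ha hb => rw [map_add, Matrix.add_mulVec, ha, hb, add_smul, map_add, map_add]
  | monomial i c =>
    rw [aeval_monomial, ← Algebra.smul_def, Matrix.smul_mulVec, configPair_fst_pow_mulVec,
      ← map_smul, ← map_smul, ← C_mul_X_pow_eq_monomial, ← smul_eq_C_mul, smul_assoc]

/-- As m annihilates H⁰, m(A) = 0, and spectral mapping makes every eigenvalue of A a root of m,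
hence a point of D. For surjectivity, a section represented by ∑ X^i e_i with i < r corresponds to ∑
A^i ι(e_i). -/
theorem RootFactor.isConfiguration {l r : ℕ} {f : EndPoly V l} {D : Set ℂ} {m n : ℂ[X]}
    (h : RootFactor f D m n) (hr : m.natDegree = r)
    (φ : cokerSections f D ≃ₗ[ℂ] (Fin r → ℂ)) : IsConfiguration V D r (configPair f D φ) where
  spectrum_subset := by
    intro x hx
    refine h.mem_of_isRoot x (by_contra fun hmx => ?_)
    have h1 : aeval (configPair f D φ).1 m = 0 := by
      refine Matrix.toLin'.injective (LinearMap.ext fun w => ?_)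
      obtain ⟨p, hp⟩ := polyClass_surjective h.det_ne_zero D (φ.symm w)
      have h2 := configPair_fst_aeval_mulVec f D φ m p
      rw [h.polyClass_smul, map_zero, hp, φ.apply_symm_apply] at h2
      simpa using h2
    have h2 := spectrum.subset_polynomial_aeval (configPair f D φ).1 m ⟨x, hx, rfl⟩
    rw [h1, spectrum.mem_iff, sub_zero] at h2
    exact h2 ((isUnit_iff_ne_zero.2 hmx).map (algebraMap ℂ _))
  surjective := by
    intro w
    obtain ⟨e, he⟩ := h.redClass_surjective hr (φ.symm w)
    refine ⟨fun i => ∑ k, e k i • Module.finBasis ℂ V k, ?_⟩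
    have h1 : ∀ i : Fin r, ((configPair f D φ).1 ^ (i : ℕ)).mulVec
        ((configPair f D φ).2 (∑ k, e k i • Module.finBasis ℂ V k)) =
        φ (polyClass f D ((X : ℂ[X]) ^ (i : ℕ) • fun k => C (e k i))) := by
      intro i
      rw [← configPair_fst_pow_mulVec]
      congr 1
      change φ (cokerConst f D _) = _
      rw [cokerConst_eq_polyClass]
      congr 2
      funext k
      rw [Module.Basis.repr_sum_self]
    simp only [h1, ← map_sum]
    rw [← φ.apply_symm_apply w, ← he]
    change _ = φ (polyClass f D (inclPoly _ r e))
    congr 2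
    funext k
    rw [inclPoly_apply, Finset.sum_apply]
    refine Finset.sum_congr rfl fun i _ => ?_
    rw [Pi.smul_apply, smul_eq_mul, mul_comm, smul_eq_C_mul]

/-- The two pairs are conjugate under φ ∘ ψ⁻¹. -/
theorem Conf.mk_configPair_eq {l r : ℕ} {f : EndPoly V l} {D : Set ℂ}
    (φ ψ : cokerSections f D ≃ₗ[ℂ] (Fin r → ℂ))
    (hφ : IsConfiguration V D r (configPair f D φ))
    (hψ : IsConfiguration V D r (configPair f D ψ)) : Conf.mk _ hφ = Conf.mk _ hψ := by
  refine Quotient.sound ?_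
  let g : GL (Fin r) ℂ :=
    { val := LinearMap.toMatrix' (φ.toLinearMap ∘ₗ ψ.symm.toLinearMap)
      inv := LinearMap.toMatrix' (ψ.toLinearMap ∘ₗ φ.symm.toLinearMap)
      val_inv := by
        rw [← LinearMap.toMatrix'_comp, ← LinearMap.toMatrix'_id]
        congr 1
        refine LinearMap.ext fun w => ?_
        simp
      inv_val := by
        rw [← LinearMap.toMatrix'_comp, ← LinearMap.toMatrix'_id]
        congr 1
        refine LinearMap.ext fun w => ?_
        simp }
  refine ⟨g, Subtype.ext (Prod.ext ?_ ?_)⟩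
  · change LinearMap.toMatrix' (φ.toLinearMap ∘ₗ ψ.symm.toLinearMap) * (configPair f D ψ).1 *
      LinearMap.toMatrix' (ψ.toLinearMap ∘ₗ φ.symm.toLinearMap) = (configPair f D φ).1
    rw [configPair, configPair, ← LinearMap.toMatrix'_comp, ← LinearMap.toMatrix'_comp]
    congr 1
    refine LinearMap.ext fun w => ?_
    simp
  · refine ContinuousLinearMap.ext fun v => ?_
    change (LinearMap.toMatrix' (φ.toLinearMap ∘ₗ ψ.symm.toLinearMap)).mulVec
      (ψ (cokerConst f D v)) = φ (cokerConst f D v)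
    rw [LinearMap.toMatrix'_mulVec]
    simp

/-- Locally, the isomorphisms `H⁰(D, Coker f̃) ≃ ℂ^r` can be chosen so that the pair depends
continuously on `f` and on the roots in `D`. -/
theorem exists_continuousAt_configPair {Y : Type*} [TopologicalSpace Y] {l r : ℕ} {D : Set ℂ}
    {f : Y → EndPoly V l} (hf : Continuous f) {m n : Y → ℂ[X]} (hmc : ContPoly m)
    (hr : ∀ y, (m y).natDegree = r) (h : ∀ y, RootFactor (f y) D (m y) (n y)) (y₀ : Y) :
    ∃ φ : ∀ y, cokerSections (f y) D ≃ₗ[ℂ] (Fin r → ℂ),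
      ContinuousAt (fun y => configPair (f y) D (φ y)) y₀ := by
  have hmonic : ∀ y, (m y).Monic := fun y => (h y).monic
  obtain ⟨s, ψ, hψ, hev⟩ := exists_continuousAt_coker
    (continuous_redMul hmc hmonic hr (contPoly_matPoly hf))
    (fun y => (h y).finrank_range_redMul_add (hr y)) y₀
  -- Near y₀ the map ψ y descends to the required isomorphism. Elsewhere any isomorphism will do,
  -- since only continuity at y₀ is claimed.
  have hφ : ∀ y, ∃ φ : cokerSections (f y) D ≃ₗ[ℂ] (Fin r → ℂ),
      (LinearMap.ker (ψ y : (Fin (Module.finrank ℂ V) → Fin r → ℂ) →ₗ[ℂ] (Fin r → ℂ)) =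
        LinearMap.range (redMul r (f y).matPoly (m y) :
          (Fin (Module.finrank ℂ V) → Fin r → ℂ) →ₗ[ℂ] (Fin (Module.finrank ℂ V) → Fin r → ℂ)) ∧ ∀ w, ψ y (s w) = w) →
      ∀ e, φ (redClass (f y) D r e) = ψ y e := by
    intro y
    by_cases hy : LinearMap.ker (ψ y : (Fin (Module.finrank ℂ V) → Fin r → ℂ) →ₗ[ℂ]
        (Fin r → ℂ)) = LinearMap.range (redMul r (f y).matPoly (m y) :
          (Fin (Module.finrank ℂ V) → Fin r → ℂ) →ₗ[ℂ] (Fin (Module.finrank ℂ V) → Fin r → ℂ)) ∧ ∀ w, ψ y (s w) = w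
    · obtain ⟨φ, hφ⟩ := exists_equiv_of_ker_eq
        (φ := (ψ y : (Fin (Module.finrank ℂ V) → Fin r → ℂ) →ₗ[ℂ] (Fin r → ℂ)))
        ((h y).redClass_surjective (hr y))
        (fun w => ⟨s w, hy.2 w⟩) (((h y).ker_redClass (hr y)).trans hy.1.symm)
      exact ⟨φ, fun _ => hφ⟩
    · obtain ⟨φ⟩ := (h y).nonempty_equiv (hr y)
      exact ⟨φ, fun h => absurd h hy⟩
  choose φ hφ using hφ
  refine ⟨φ, ?_⟩
  let Z : Y → (Fin (Module.finrank ℂ V) → Fin r → ℂ) →L[ℂ] (Fin (Module.finrank ℂ V) → Fin r → ℂ) :=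
    fun y => redMul r ((X : ℂ[X]) • (1 : Matrix _ _ ℂ[X])) (m y)
  have hZ : Continuous Z := continuous_redMul hmc hmonic hr fun i j => ContPoly.const _
  have hj := continuous_redConst (V := V) hmc hmonic hr
  -- Since s is a section of ψ y near y₀, the pair there has an explicit form: its matrix is ψ y ∘ Z
  -- y ∘ s, written column by column, and its second entry is ψ y after `redConst`.
  have hcont : ContinuousAt (fun y =>
      ((Matrix.of fun i j => ψ y (Z y (s (Pi.single j 1))) i : Matrix (Fin r) (Fin r) ℂ),
        (ψ y).comp (redConst V r (m y)))) y₀ := by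
    refine ContinuousAt.prodMk ?_ (hψ.clm_comp hj.continuousAt)
    refine continuousAt_pi.2 fun i => continuousAt_pi.2 fun j => ?_
    have h1 : ContinuousAt (fun y => ψ y (Z y (s (Pi.single j 1)))) y₀ :=
      hψ.clm_apply (hZ.clm_apply continuous_const).continuousAt
    exact (continuous_apply i).continuousAt.comp h1
  refine hcont.congr ?_
  filter_upwards [hev] with y hy
  have key := hφ y hy
  refine Prod.ext ?_ ?_
  · ext i j
    change ψ y (Z y (s (Pi.single j 1))) i = LinearMap.toMatrix' ((φ y).toLinearMap ∘ₗ
      cokerSectionsZ (f y) D ∘ₗ (φ y).symm.toLinearMap) i j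
    rw [LinearMap.toMatrix'_apply]
    change _ = φ y (cokerSectionsZ (f y) D ((φ y).symm _)) i
    have h1 : (φ y).symm (Pi.single j 1) = redClass (f y) D r (s (Pi.single j 1)) := by
      rw [LinearEquiv.symm_apply_eq, key, hy.2]
    simp only [h1]
    rw [← (h y).redClass_redMul_X (hr y), key]
  · refine ContinuousLinearMap.ext fun v => ?_
    change ψ y (redConst V r (m y) v) = φ y (cokerConst (f y) D v)
    rw [← (h y).redClass_redConst (hr y), key]

end Pair

end ConfigMap

end

/-! ### The configuration map and its continuity. -/

theorem mainTheorem3 {V : Type*} [NormedAddCommGroup V] [NormedSpace ℂ V] [FiniteDimensional ℂ V]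
    (l r : ℕ) (γ : C(Circle, ℂ)) (hγ : Function.Injective γ)
    (D : Set ℂ) (hD : ConfigMap.IsBoundedComponent (Set.range γ) D) :
    (∀ f ∈ ConfigMap.polySpace V (Set.range γ) D l r,
      Nonempty (ConfigMap.cokerSections f D ≃ₗ[ℂ] (Fin r → ℂ))) ∧
    ∃ conf : ConfigMap.polySpace V (Set.range γ) D l r → ConfigMap.Conf V D r,
      (∀ (f : ConfigMap.polySpace V (Set.range γ) D l r)
        (φ : ConfigMap.cokerSections f.1 D ≃ₗ[ℂ] (Fin r → ℂ)),
        ∃ h : ConfigMap.IsConfiguration V D r (ConfigMap.configPair f.1 D φ),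
          conf f = ConfigMap.Conf.mk (ConfigMap.configPair f.1 D φ) h) ∧
      Continuous conf := by
  have hK : (Set.range γ).Nonempty := Set.range_nonempty γ
  have hfac : ∀ f ∈ ConfigMap.polySpace V (Set.range γ) D l r,
      ∃ c : Fin r → ℂ, ∃ n, ConfigMap.RootFactor f D (ConfigMap.rootPoly c) n := fun f hf => by
    obtain ⟨c, hc, hdvd⟩ := ConfigMap.exists_rootPoly_dvd hK hf
    exact ⟨c, ConfigMap.rootFactor_of_dvd hK hf hc hdvd⟩
  have hne : ∀ f ∈ ConfigMap.polySpace V (Set.range γ) D l r,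
      Nonempty (ConfigMap.cokerSections f D ≃ₗ[ℂ] (Fin r → ℂ)) := fun f hf => by
    obtain ⟨c, n, h⟩ := hfac f hf
    exact h.nonempty_equiv (ConfigMap.natDegree_rootPoly c)
  have hconf : ∀ (f : ConfigMap.polySpace V (Set.range γ) D l r)
      (φ : ConfigMap.cokerSections f.1 D ≃ₗ[ℂ] (Fin r → ℂ)),
      ConfigMap.IsConfiguration V D r (ConfigMap.configPair f.1 D φ) := fun f φ => by
    obtain ⟨c, n, h⟩ := hfac f.1 f.2
    exact h.isConfiguration (ConfigMap.natDegree_rootPoly c) φ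
  let φ₀ := fun f : ConfigMap.polySpace V (Set.range γ) D l r => (hne f.1 f.2).some
  refine ⟨hne, fun f => ConfigMap.Conf.mk _ (hconf f (φ₀ f)), fun f φ => ⟨hconf f φ,
    ConfigMap.Conf.mk_configPair_eq _ _ _ _⟩, ?_⟩
  -- The choice φ₀ has no continuity. On the cover it is traded, near each point, for a choice φ
  -- making the pair continuous; the class in the quotient is the same.
  rw [(ConfigMap.isQuotientMap_rootCover hK hD.isBounded l r).continuous_iff,
    continuous_iff_continuousAt]
  intro y₀
  have hy : ∀ y : ConfigMap.rootCover V (Set.range γ) D l r, ∃ n,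
      ConfigMap.RootFactor y.1.1.1 D (ConfigMap.rootPoly fun i => (y.1.2 i : ℂ)) n := fun y =>
    ConfigMap.rootFactor_of_dvd hK y.1.1.2
      (ConfigMap.mem_of_rootPoly_dvd hD y.1.1.2 (fun i => (y.1.2 i).2) y.2) y.2
  choose n hn using hy
  obtain ⟨φ, hφ⟩ := ConfigMap.exists_continuousAt_configPair
    (f := fun y : ConfigMap.rootCover V (Set.range γ) D l r => y.1.1.1) (by fun_prop)
    (ConfigMap.contPoly_rootPoly (by fun_prop)) (fun y => ConfigMap.natDegree_rootPoly _) hn y₀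
  have hlift : ContinuousAt (fun y : ConfigMap.rootCover V (Set.range γ) D l r =>
      (⟨_, hconf y.1.1 (φ y)⟩ : ConfigMap.PreConf V D r)) y₀ :=
    Topology.IsInducing.subtypeVal.continuousAt_iff.2 hφ
  have hmk : Continuous (Quotient.mk (MulAction.orbitRel (GL (Fin r) ℂ)
    (ConfigMap.PreConf V D r))) := continuous_quotient_mk'
  refine (hmk.continuousAt.comp hlift).congr (Filter.Eventually.of_forall fun y => ?_)
  exact ConfigMap.Conf.mk_configPair_eq _ _ _ (hconf y.1.1 (φ₀ y.1.1))
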